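/- Fix a prime $b$. For $k\in\mathbb N$ let $\psi_b(k)=\lfloor\log_b k\rfloor$, and for $\alpha>1$ put $r_\alpha(0)=1$, $r_\alpha(k)=b^{\alpha\psi_b(k)}$ ($k\ge1$), and $\mu_b(\alpha)=\sum_{k\ge1}r_\alpha(k)^{-1}$. For strictly positive weights $\boldsymbol\gamma=(\gamma_{\mathfrak u})$ indexed by the finite sets $\mathfrak u\subset\mathbb N$ and for $d\in\mathbb N$, let $W^\alpha_{d,\boldsymbol\gamma}$ be the space of the functions $f\in L^2([0,1]^d)$ that are represented on $[0,1)^d$ by their Walsh series in base $b$, $f(\boldsymbol x)=\sum_{\boldsymbol k\in\mathbb N_0^d}\hat f(\boldsymbol k)\,\mathrm{wal}_{\boldsymbol k}(\boldsymbol x)$, and whose norm $\|f\|=\sup_{\boldsymbol k}|\hat f(\boldsymbol k)|\,\gamma_{\operatorname{supp}(\boldsymbol k)}^{-1}\prod_{j=1}^d r_\alpha(k_j)$ is finite. For a polynomial $p\in\mathbb F_b[x]$ of degree $m$ and $\boldsymbol g\in(\mathbb F_b[x])^d$ let $\boldsymbol x_n=\big(v_m(n(x)g_j(x)/p(x))\big)_{j=1}^d$,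 $0\le n<N=b^m$, where $n(x)=\sum_k n_kx^k$ for $n=\sum_k n_kb^k$ in base $b$, and $v_m\big(\sum_{\ell\ge w}t_\ell x^{-\ell}\big)=\sum_{\ell=\max(1,w)}^m t_\ell b^{-\ell}$. Let $e_{N,d,\alpha,\boldsymbol\gamma}(\boldsymbol g)=\sup_{\|f\|\le1}\big|\frac1N\sum_{n<N}f(\boldsymbol x_n)-\int_{[0,1]^d}f\big|$ be the worst-case error in $W^\alpha_{d,\boldsymbol\gamma}$. Let $G^*_{b,m}$ be the set of non-zero polynomials in $\mathbb F_b[x]$ of degree less than $m$. For $p$ irreducible of degree $m$ and positive weights $\boldsymbol\eta$, the component-by-component (CBC) algorithm with weights $\boldsymbol\eta$ and modulus $p$ sets $g_1=1$ and, for $s=2,\dots,d$, takes for $g_s$ a minimizer over $g\in G^*_{b,m}$ (any one, in case of ties) of $K_s(g_1,\dots,g_{s-1},g)$, where $$K_s(\boldsymbol g)=\sum_{\emptyset\ne\mathfrak u\subseteq\{1,\dots,s\}}\eta_{\mathfrak u}\sum_{n=1}^{b^m-1}\prod_{j\in\mathfrak u}\Big((1-b)\Big\lfloor\log_b v_m\Big(\tfrac{n(x)g_j(x)}{p(x)}\Big)\Big\rfloor-b\Big).$$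 **Theorem.** (i) Let $\boldsymbol\gamma$ be positive weights with $\sum_{j\ge1}\max_{\mathfrak v\subseteq\{1,\dots,j-1\}}\gamma_{\mathfrak v\cup\{j\}}/\gamma_{\mathfrak v}<\infty$, and let $\delta>0$. There is a constant $C_1(\boldsymbol\gamma,\delta)>0$, which may depend on $b$, $\boldsymbol\gamma$ and $\delta$ but on nothing else (in particular not on $d$, $N$, $p$ or $\alpha$), such that for all $m\ge4$, $d\ge1$ and irreducible $p\in\mathbb F_b[x]$ of degree $m$ the CBC algorithm with weights $\boldsymbol\gamma$ produces a vector, and every vector $\boldsymbol g$ that it can produce lies in $(G^*_{b,m})^d$ and satisfies, with $N=b^m$, simultaneously for all $\alpha>1$, $$e_{N,d,\alpha,\boldsymbol\gamma^\alpha}(\boldsymbol g)\le\frac1{N^\alpha}\Big(\sum_{\emptyset\ne\mathfrak u\subseteq\{1,\dots,d\}}\gamma_{\mathfrak u}^\alpha(2\mu_b(\alpha))^{|\mathfrak u|}+C_1(\boldsymbol\gamma,\delta)^\alpha N^{\alpha\delta}\Big).$$ (ii) Let $\alpha>1$, let $\boldsymbol\gamma$ be positive weights with $\sum_{j\ge1}\max_{\mathfrak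 v\subseteq\{1,\dots,j-1\}}(\gamma_{\mathfrak v\cup\{j\}}/\gamma_{\mathfrak v})^{1/\alpha}<\infty$, and let $\delta>0$. There is a constant $C_2(\boldsymbol\gamma^{1/\alpha},\delta)>0$, which depends only on $b$, $\delta$ and the weights $\boldsymbol\gamma^{1/\alpha}$ (in particular not on $d$, $N$ or $p$), such that for all $m\ge4$, $d\ge1$ and irreducible $p\in\mathbb F_b[x]$ of degree $m$ the CBC algorithm with weights $\boldsymbol\gamma^{1/\alpha}$ produces a vector, and every vector $\widetilde{\boldsymbol g}$ that it can produce lies in $(G^*_{b,m})^d$ and satisfies, with $N=b^m$, $$e_{N,d,\alpha,\boldsymbol\gamma}(\widetilde{\boldsymbol g})\le\frac1{N^\alpha}\Big(\sum_{\emptyset\ne\mathfrak u\subseteq\{1,\dots,d\}}\gamma_{\mathfrak u}(2\mu_b(\alpha))^{|\mathfrak u|}+C_2(\boldsymbol\gamma^{1/\alpha},\delta)^\alpha N^{\alpha\delta}\Big).$$ -/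

import Mathlib

open scoped ENNReal Polynomial

noncomputable section

namespace PolyLattice

/-! Conventions. `b` is a prime and `ZMod b` is the field with `b` elements. Coordinates are numbered
from `0`: the index set `{1, …, d}` is `Finset.range d`, and the coordinate `j` here is the coordinate
`j + 1` in the usual numbering. A family of weights is a function `γ : Finset ℕ → ℝ`, so that the
weights of all dimensions `d` are the restrictions of one family to the subsets of `Finset.range d`. -/

/-! ### Digits, Walsh functions, Walsh coefficients -/

/-- The coefficient of `b ^ i` in the base `b` expansion of `k`. -/
def natDigit (b k i : ℕ) : ℕ := k / b ^ i % b

/-- The number of digits of `k` in base `b` (it is `0` for `k = 0`). -/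
def natLen (b k : ℕ) : ℕ := (Nat.digits b k).length

/-- The coefficient `ξ (i + 1)` of `b ^ (-(i + 1))` in the base `b` expansion of `x ∈ [0, 1)` that
has infinitely many digits different from `b - 1`. -/
def realDigit (b : ℕ) (x : ℝ) (i : ℕ) : ℕ := ⌊x * (b : ℝ) ^ (i + 1)⌋₊ % b

/-- The `k`-th Walsh function in base `b`. -/
def wal (b k : ℕ) (x : ℝ) : ℂ :=
  Complex.exp (2 * Real.pi * Complex.I *
    ((∑ i ∈ Finset.range (natLen b k), natDigit b k i * realDigit b x i : ℕ) : ℂ) / (b : ℂ))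

/-- The multivariate Walsh function. -/
def walVec (b : ℕ) {d : ℕ} (k : Fin d → ℕ) (x : Fin d → ℝ) : ℂ := ∏ j, wal b (k j) (x j)

/-- The integral over the unit cube. -/
def cubeIntegral {d : ℕ} (f : (Fin d → ℝ) → ℂ) : ℂ := ∫ x in Set.Icc (0 : Fin d → ℝ) 1, f x

/-- The `k`-th Walsh coefficient of `f`. -/
def walshCoeff (b : ℕ) {d : ℕ} (f : (Fin d → ℝ) → ℂ) (k : Fin d → ℕ) : ℂ :=
  cubeIntegral fun x => f x * (starRingEnd ℂ) (walVec b k x)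

/-! ### The weighted Walsh space -/

/-- The decay function `r_α`; `Nat.log b k` is the integer part of the logarithm of `k ≥ 1`. -/
def decay (b : ℕ) (α : ℝ) (k : ℕ) : ℝ := if k = 0 then 1 else (b : ℝ) ^ (α * (Nat.log b k : ℝ))

/-- `μ_b(α)`, the sum of `1 / r_α(k)` over all `k ≥ 1`. -/
def mu (b : ℕ) (α : ℝ) : ℝ := ∑' k : ℕ, (decay b α (k + 1))⁻¹

/-- The support of an integer vector, as a subset of `Finset.range d`. -/
def vecSupp {d : ℕ} (k : Fin d → ℕ) : Finset ℕ :=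
  (Finset.univ.filter fun j => k j ≠ 0).map Fin.valEmbedding

/-- The weighted decay function `r_{α,γ}`. -/
def weightedDecay (b : ℕ) (α : ℝ) (γ : Finset ℕ → ℝ) {d : ℕ} (k : Fin d → ℕ) : ℝ :=
  (γ (vecSupp k))⁻¹ * ∏ j, decay b α (k j)

/-- The norm of the weighted Walsh space (`∞` when the supremum is not finite). -/
def walshNorm (b : ℕ) (α : ℝ) (γ : Finset ℕ → ℝ) {d : ℕ} (f : (Fin d → ℝ) → ℂ) : ℝ≥0∞ :=
  ⨆ k : Fin d → ℕ, ENNReal.ofReal (‖walshCoeff b f k‖ * weightedDecay b α γ k)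

/-- The weighted Walsh space: the square integrable functions of finite norm, each taken as the
function on `[0, 1)^d` that its Walsh series represents (so that point values make sense). -/
def walshSpace (b : ℕ) (α : ℝ) (γ : Finset ℕ → ℝ) (d : ℕ) : Set ((Fin d → ℝ) → ℂ) :=
  {f | MeasureTheory.MemLp f 2 (MeasureTheory.volume.restrict (Set.Icc (0 : Fin d → ℝ) 1)) ∧
    (∀ x : Fin d → ℝ, (∀ j, x j ∈ Set.Ico (0 : ℝ) 1) →
      HasSum (fun k : Fin d → ℕ => walshCoeff b f k * walVec b k x) (f x)) ∧
    walshNorm b α γ f < ⊤}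

/-- The QMC rule with the `N` points `x 0, …, x (N - 1)`. -/
def qmc {d : ℕ} (N : ℕ) (x : ℕ → Fin d → ℝ) (f : (Fin d → ℝ) → ℂ) : ℂ :=
  1 / (N : ℂ) * ∑ n ∈ Finset.range N, f (x n)

/-- The worst-case error of a QMC rule over the unit ball of the weighted Walsh space. -/
def worstCaseError (b : ℕ) (α : ℝ) (γ : Finset ℕ → ℝ) {d : ℕ} (N : ℕ) (x : ℕ → Fin d → ℝ) :
    ℝ≥0∞ :=
  ⨆ f ∈ {f ∈ walshSpace b α γ d | walshNorm b α γ f ≤ 1},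
    ENNReal.ofReal ‖qmc N x f - cubeIntegral f‖

/-! ### Polynomial lattice point sets -/

section Lattice

variable (b : ℕ) [Fact b.Prime]

/-- The polynomial `n(x)` whose coefficients are the base `b` digits of `n`. -/
def natPoly (n : ℕ) : (ZMod b)[X] :=
  ∑ i ∈ Finset.range (natLen b n), Polynomial.C ((natDigit b n i : ℕ) : ZMod b) * Polynomial.X ^ i

/-- The embedding of polynomials in `x` into the field of formal Laurent series in `x⁻¹`. That field
is `LaurentSeries (ZMod b)`, whose variable stands for `x⁻¹`: the coefficient of index `l` belongs
to `x ^ (-l)`, and `x` itself is `single (-1) 1`. -/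
def toSeries (q : (ZMod b)[X]) : LaurentSeries (ZMod b) :=
  Polynomial.aeval (HahnSeries.single (-1 : ℤ) (1 : ZMod b) : LaurentSeries (ZMod b)) q

/-- The map `v_m` from Laurent series in `x⁻¹` to `[0, 1)`. -/
def vMap (m : ℕ) (L : LaurentSeries (ZMod b)) : ℝ :=
  ∑ l ∈ Finset.Icc 1 m, ((L.coeff (l : ℤ)).val : ℝ) * ((b : ℝ) ^ l)⁻¹

/-- One coordinate `v_m(n(x) g(x) / p(x))` of the `n`-th point. -/
def latticeCoord (m : ℕ) (p g : (ZMod b)[X]) (n : ℕ) : ℝ :=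
  vMap b m (toSeries b (natPoly b n) * toSeries b g / toSeries b p)

/-- The polynomial lattice point set `x_n`, `n < b ^ m`, with modulus `p` of degree `m` and
generating vector `g`. -/
def latticePoint (m : ℕ) (p : (ZMod b)[X]) {d : ℕ} (g : Fin d → (ZMod b)[X]) (n : ℕ) : Fin d → ℝ :=
  fun j => latticeCoord b m p (g j) n

/-- The set of non-zero polynomials of degree less than `m`. -/
def Gstar (m : ℕ) : Set (ZMod b)[X] := {g | g ≠ 0 ∧ g.degree < m}

/-- The worst-case error of the polynomial lattice rule. -/
def latticeError (α : ℝ) (γ : Finset ℕ → ℝ) (m : ℕ) (p : (ZMod b)[X]) {d : ℕ}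
    (g : Fin d → (ZMod b)[X]) : ℝ≥0∞ :=
  worstCaseError b α γ (b ^ m) (latticePoint b m p g)

/-! ### The component-by-component construction -/

/-- The quality function `K_{b^m,s,η}(g)` (the sum runs over the non-empty sets `u` of coordinates;
the product over `j ∈ u` is `L_u` at the projection of the `n`-th point). -/
def quality (η : Finset ℕ → ℝ) (m : ℕ) (p : (ZMod b)[X]) {s : ℕ} (g : Fin s → (ZMod b)[X]) : ℝ :=
  ∑ u ∈ (Finset.univ : Finset (Fin s)).powerset.erase ∅,
    η (u.map Fin.valEmbedding) * ∑ n ∈ Finset.Icc 1 (b ^ m - 1),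
      ∏ j ∈ u, ((1 - (b : ℝ)) * (⌊Real.logb b (latticeCoord b m p (g j) n)⌋ : ℝ) - b)

/-- `CBC b η m p s g`: the vector `g = (g_1, …, g_s)` is a possible state after `s` components of the
component-by-component algorithm with weights `η` and modulus `p`. The first component is `1`, and
each later one is a minimizer (any one, in case of ties) of the quality function. -/
inductive CBC (η : Finset ℕ → ℝ) (m : ℕ) (p : (ZMod b)[X]) :
    (s : ℕ) → (Fin s → (ZMod b)[X]) → Prop
  | first : CBC η m p 1 fun _ => 1
  | step (s : ℕ) (g : Fin s → (ZMod b)[X]) (h : (ZMod b)[X]) (hg : CBC η m p s g)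
      (hh : h ∈ Gstar b m)
      (hmin : ∀ h' ∈ Gstar b m,
        quality b η m p (Fin.snoc (α := fun _ => (ZMod b)[X]) g h) ≤
          quality b η m p (Fin.snoc (α := fun _ => (ZMod b)[X]) g h')) :
      CBC η m p (s + 1) (Fin.snoc (α := fun _ => (ZMod b)[X]) g h)

end Lattice

/-- The maximum of `F v` over all sets `v` of coordinates that precede the coordinate `j`. -/
def maxPreceding (j : ℕ) (F : Finset ℕ → ℝ) : ℝ :=
  (Finset.range j).powerset.sup' (Finset.powerset_nonempty _) F

/-- The error bound `N^(-α) (∑ γ_u (2 μ_b(α))^|u| + C^α N^(αδ))` for `N = b ^ m`, the sum being over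
the non-empty subsets `u` of the set of the first `d` coordinates. -/
def errorBound (b : ℕ) (α δ C : ℝ) (γ : Finset ℕ → ℝ) (m d : ℕ) : ℝ :=
  1 / ((b : ℝ) ^ m) ^ α *
    ((∑ u ∈ (Finset.range d).powerset.erase ∅, γ u * (2 * mu b α) ^ u.card)
      + C ^ α * ((b : ℝ) ^ m) ^ (α * δ))

end PolyLattice

end

open PolyLattice

/-!
The dual lattice of the point set consists of the `k` whose Walsh function is trivial on all points
(`InDual`). The mean of a Walsh function over the points is `1` on the dual lattice and `0` off it, so
the worst-case error is at most the sum of `1 / r_{α,γ}(k)` over the non-zero `k` in the dual lattice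
(`qmc_sub_cubeIntegral_le`). With `N = b ^ m`, this sum is split by the size of the entries
(`tsum_dual_le`).

* If some entry `k j` is at least `N`, then its digits below the `m`-th are determined by the rest of
  `k`, since `g j` is invertible modulo `p`. Dividing `k j` by `N` turns `r_α` into `r_α / N ^ α`, so
  for the support `u` these `k` contribute at most `|u| μ ^ |u| / N ^ α ≤ (2 μ) ^ |u| / N ^ α`, times the
  weight (`tsum_dual_large_le`).
* If all entries are less than `N`, then `r_{α,γ^α} = r_{1,γ} ^ α`, and Jensen's inequality bounds the
  contribution by `T ^ α`, where `T = truncError` is the corresponding sum for `α = 1`. This is why one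
  vector serves all `α`.

The kernel `∑ wal_k / r_1(k)` over `1 ≤ k < N` has a closed form, which is the factor of the quality
function (`sum_decay_walChar`). Hence `N T` is the quality function plus the term of the point `0`,
where the kernel equals `m (b - 1)`. In each step of the algorithm the average of the new part of the
quality function over all candidates is explicit, because for every `n ≥ 1` the points of all
candidates run through all non-zero digit vectors (`min_increment_le`). By induction
`T ≤ (N - 1)⁻¹ ∑ η_u (m (b - 1)) ^ |u|` (`CBC.truncError_le`). That sum is at most a product
`∏ (1 + m (b - 1) c_j)` with summable `c_j`, which is `O(N ^ δ)` uniformly in the dimension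
(`exists_prod_one_add_le`).

Weights `γ` and exponent `α` in the second part amount to the weights `γ ^ (1 / α)` in the first.
-/

noncomputable section

namespace PolyLattice

/-! ### Base `b` digits of integers -/

theorem natDigit_eq_zero_of_natLen_le {b k i : ℕ} (hb : 1 < b) (h : natLen b k ≤ i) :
    natDigit b k i = 0 := by
  unfold natDigit
  rw [Nat.div_eq_of_lt, Nat.zero_mod]
  exact (Nat.lt_base_pow_length_digits hb).trans_le (Nat.pow_le_pow_right hb.le h)

theorem mod_pow_eq_of_natDigit_eq {b k l m : ℕ} (h : ∀ i < m, natDigit b k i = natDigit b l i) :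
    k % b ^ m = l % b ^ m := by
  induction m with
  | zero => simp [Nat.mod_one]
  | succ m ih =>
    have h1 := ih fun i hi => h i (by omega)
    have h2 := h m (by omega)
    unfold natDigit at h2
    rw [Nat.mod_pow_succ, Nat.mod_pow_succ, h1, h2]

theorem sum_range_pow_succ {M : Type*} [AddCommMonoid M] (b a : ℕ) (F : ℕ → M) :
    ∑ k ∈ Finset.range (b ^ (a + 1)), F k =
      ∑ c ∈ Finset.range b, ∑ r ∈ Finset.range (b ^ a), F (r + b ^ a * c) := by
  rw [← Finset.sum_product', eq_comm]
  refine Finset.sum_bij' (fun x _ => x.2 + b ^ a * x.1) (fun k _ => (k / b ^ a, k % b ^ a)) ?_ ?_ ?_ ?_ ?_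
  · rintro ⟨c, r⟩ h
    simp only [Finset.mem_product, Finset.mem_range] at h ⊢
    calc r + b ^ a * c < b ^ a + b ^ a * c := by omega
      _ = b ^ a * (c + 1) := by ring
      _ ≤ b ^ a * b := Nat.mul_le_mul_left _ h.1
      _ = b ^ (a + 1) := by ring
  · intro k h
    simp only [Finset.mem_product, Finset.mem_range] at h ⊢
    have hb : 0 < b ^ a := by
      rcases Nat.eq_zero_or_pos (b ^ a) with h0 | h0
      · rw [pow_succ, h0] at h; simp at h
      · exact h0
    exact ⟨Nat.div_lt_of_lt_mul (by rwa [pow_succ] at h), Nat.mod_lt _ hb⟩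
  · rintro ⟨c, r⟩ h
    simp only [Finset.mem_product, Finset.mem_range] at h
    have hb : 0 < b ^ a := by omega
    simp [Nat.add_mul_div_left _ _ hb, Nat.div_eq_of_lt h.2, Nat.mod_eq_of_lt h.2]
  · intro k _
    exact Nat.mod_add_div k (b ^ a)
  · intros; rfl

section
variable (b : ℕ) [Fact b.Prime]

/-- The vector of the first `m` base `b` digits of `k`, over the field with `b` elements. -/
def digitVec (m k : ℕ) : Fin m → ZMod b := fun i => (natDigit b k i : ℕ)

variable {b}

theorem natDigit_lt (k i : ℕ) : natDigit b k i < b :=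
  Nat.mod_lt _ (Fact.out : b.Prime).pos

theorem mod_pow_eq_of_digitVec_eq {m k l : ℕ} (h : digitVec b m k = digitVec b m l) :
    k % b ^ m = l % b ^ m := by
  refine mod_pow_eq_of_natDigit_eq fun i hi => ?_
  have h1 := congrArg ZMod.val (congrFun h ⟨i, hi⟩)
  simpa [digitVec, ZMod.val_natCast, Nat.mod_eq_of_lt (natDigit_lt _ _)] using h1

theorem digitVec_zero (m : ℕ) : digitVec b m 0 = 0 := by
  ext i; simp [digitVec, natDigit]

theorem digitVec_ne_zero {m k : ℕ} (h0 : k ≠ 0) (hk : k < b ^ m) : digitVec b m k ≠ 0 := by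
  intro h
  rw [← digitVec_zero] at h
  have := mod_pow_eq_of_digitVec_eq h
  rw [Nat.mod_eq_of_lt hk, Nat.zero_mod] at this
  exact h0 this

theorem digitVec_bijective (m : ℕ) :
    Function.Bijective fun n : Fin (b ^ m) => digitVec b m n := by
  rw [Fintype.bijective_iff_injective_and_card]
  refine ⟨fun k l h => ?_, by simp⟩
  have := mod_pow_eq_of_digitVec_eq h
  rw [Nat.mod_eq_of_lt k.2, Nat.mod_eq_of_lt l.2] at this
  exact Fin.ext this

theorem sum_digitVec {M : Type*} [AddCommMonoid M] (m : ℕ) (F : (Fin m → ZMod b) → M) :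
    ∑ n ∈ Finset.range (b ^ m), F (digitVec b m n) = ∑ c, F c := by
  rw [Finset.sum_range fun n => F (digitVec b m n)]
  exact (digitVec_bijective m).sum_comp F

/-! ### Expansions of rational functions -/

theorem toSeries_C (a : ZMod b) : toSeries b (Polynomial.C a) = HahnSeries.C a := by
  unfold toSeries
  rw [Polynomial.aeval_C, HahnSeries.algebraMap_apply']
  simp

theorem toSeries_mul (q r : (ZMod b)[X]) : toSeries b (q * r) = toSeries b q * toSeries b r :=
  map_mul _ q r

theorem toSeries_eq_sum (q : (ZMod b)[X]) :
    toSeries b q = ∑ i ∈ q.support, HahnSeries.single (-(i : ℤ)) (q.coeff i) := by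
  conv_lhs => rw [q.as_sum_support_C_mul_X_pow, toSeries, map_sum]
  refine Finset.sum_congr rfl fun i _ => ?_
  change toSeries b (Polynomial.C (q.coeff i) * Polynomial.X ^ i) = _
  rw [toSeries_mul, toSeries_C, HahnSeries.C_apply]
  simp [toSeries, HahnSeries.single_pow]

theorem coeff_toSeries_neg (q : (ZMod b)[X]) (i : ℕ) :
    (toSeries b q).coeff (-(i : ℤ)) = q.coeff i := by
  rw [toSeries_eq_sum, HahnSeries.coeff_sum]
  simp only [HahnSeries.coeff_single, neg_inj, Nat.cast_inj]
  simp +contextual [eq_comm]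

theorem coeff_toSeries_of_pos (q : (ZMod b)[X]) {l : ℤ} (hl : 0 < l) :
    (toSeries b q).coeff l = 0 := by
  rw [toSeries_eq_sum, HahnSeries.coeff_sum]
  refine Finset.sum_eq_zero fun i _ => ?_
  rw [HahnSeries.coeff_single_of_ne]
  omega

theorem toSeries_ne_zero {q : (ZMod b)[X]} (hq : q ≠ 0) : toSeries b q ≠ 0 := by
  intro h
  have := coeff_toSeries_neg q q.natDegree
  rw [h] at this
  simp at this
  exact hq (Polynomial.leadingCoeff_eq_zero.mp this.symm)

theorem order_toSeries {q : (ZMod b)[X]} (hq : q ≠ 0) :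
    (toSeries b q).order = -(q.natDegree : ℤ) := by
  refine le_antisymm (HahnSeries.order_le_of_coeff_ne_zero ?_) ?_
  · rw [coeff_toSeries_neg]; simpa using hq
  · by_contra! hlt
    have h0 := HahnSeries.coeff_order_eq_zero.not.mpr (toSeries_ne_zero hq)
    obtain ⟨i, hi⟩ : ∃ i : ℕ, (toSeries b q).order = -(i : ℤ) :=
      ⟨(-(toSeries b q).order).toNat, by omega⟩
    rw [hi, coeff_toSeries_neg] at h0
    exact h0 (Polynomial.coeff_eq_zero_of_natDegree_lt (by omega))

variable (b)

/-- The first `m` coefficients of `q / p` after the point, that is, those of `x⁻¹, …, x⁻ᵐ`. -/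
def expansion (m : ℕ) (p : (ZMod b)[X]) : (ZMod b)[X] →ₗ[ZMod b] (Fin m → ZMod b) where
  toFun q i := (toSeries b q / toSeries b p).coeff ((i : ℤ) + 1)
  map_add' q r := by
    ext i
    simp [toSeries, add_div]
  map_smul' c q := by
    ext i
    rw [Polynomial.smul_eq_C_mul, toSeries_mul, toSeries_C, mul_div_assoc, HahnSeries.C_apply]
    simp

/-- The polynomial of degree less than `m` with given coefficients. -/
def vecPoly (m : ℕ) : (Fin m → ZMod b) →ₗ[ZMod b] (ZMod b)[X] :=
  ∑ i : Fin m, (Polynomial.monomial (i : ℕ)).comp (LinearMap.proj i)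

variable {b}

theorem vecPoly_coeff {m : ℕ} (c : Fin m → ZMod b) (i : Fin m) : (vecPoly b m c).coeff i = c i := by
  simp [vecPoly, Polynomial.finsetSum_coeff, Polynomial.coeff_monomial, Fin.val_inj]

theorem vecPoly_degree_lt {m : ℕ} (c : Fin m → ZMod b) : (vecPoly b m c).degree < m := by
  rw [Polynomial.degree_lt_iff_coeff_zero]
  intro k hk
  simp only [vecPoly, LinearMap.sum_apply, Polynomial.finsetSum_coeff, LinearMap.comp_apply,
    Polynomial.coeff_monomial]
  refine Finset.sum_eq_zero fun i _ => if_neg ?_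
  omega

theorem natPoly_eq {m n : ℕ} (hn : n < b ^ m) : natPoly b n = vecPoly b m (digitVec b m n) := by
  have hb := (Fact.out : b.Prime).one_lt
  have hlen : natLen b n ≤ m := by
    unfold natLen; exact (Nat.digits_length_le_iff hb _).mpr hn
  unfold natPoly
  rw [Finset.sum_subset (Finset.range_subset_range.mpr hlen)]
  · rw [Finset.sum_range]
    simp only [vecPoly, digitVec, Polynomial.C_mul_X_pow_eq_monomial, LinearMap.sum_apply,
      LinearMap.comp_apply, LinearMap.proj_apply]
  · intro i _ hi
    rw [natDigit_eq_zero_of_natLen_le hb (by simpa using hi)]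
    simp

theorem natPoly_mem_Gstar {m n : ℕ} (h0 : n ≠ 0) (hn : n < b ^ m) : natPoly b n ∈ Gstar b m := by
  rw [natPoly_eq hn]
  refine ⟨fun h => digitVec_ne_zero h0 hn ?_, vecPoly_degree_lt _⟩
  ext i
  rw [← vecPoly_coeff (digitVec b m n) i, h]
  simp

variable {m : ℕ} {p : (ZMod b)[X]}

theorem eq_zero_of_expansion_eq_zero (hp : p ≠ 0) (hdeg : p.natDegree = m) {r : (ZMod b)[X]}
    (hr : r.degree < m) (h : expansion b m p r = 0) : r = 0 := by
  by_contra hr0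
  set s := toSeries b r / toSeries b p with hs
  have hmul : s * toSeries b p = toSeries b r := div_mul_cancel₀ _ (toSeries_ne_zero hp)
  have hs0 : s ≠ 0 := div_ne_zero (toSeries_ne_zero hr0) (toSeries_ne_zero hp)
  have hord := congrArg HahnSeries.order hmul
  rw [HahnSeries.order_mul hs0 (toSeries_ne_zero hp), order_toSeries hp, order_toSeries hr0,
    hdeg] at hord
  have hrd : r.natDegree < m := (Polynomial.natDegree_lt_iff_degree_lt hr0).mpr hr
  have h1 := congrFun h ⟨m - r.natDegree - 1, by omega⟩
  have h2 : s.coeff s.order = 0 := by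
    have h3 : s.order = ((m - r.natDegree - 1 : ℕ) : ℤ) + 1 := by omega
    rw [h3]
    exact h1
  exact HahnSeries.coeff_order_eq_zero.not.mpr hs0 h2

theorem expansion_mul_self (hp : p ≠ 0) (q : (ZMod b)[X]) : expansion b m p (p * q) = 0 := by
  ext i
  change (toSeries b (p * q) / toSeries b p).coeff _ = 0
  rw [toSeries_mul, mul_div_cancel_left₀ _ (toSeries_ne_zero hp)]
  exact coeff_toSeries_of_pos _ (by omega)

theorem dvd_of_expansion_eq_zero (hp : p ≠ 0) (hdeg : p.natDegree = m) {q : (ZMod b)[X]}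
    (h : expansion b m p q = 0) : p ∣ q := by
  rw [← EuclideanDomain.mod_eq_zero]
  refine eq_zero_of_expansion_eq_zero hp hdeg ?_ ?_
  · rw [← hdeg, ← Polynomial.degree_eq_natDegree hp]
    exact EuclideanDomain.mod_lt q hp
  · have h2 := congrArg (expansion b m p) (EuclideanDomain.div_add_mod q p)
    rwa [map_add, expansion_mul_self hp, zero_add, h] at h2

variable (m p)

/-- The linear map that takes the digits of `n` to the base `b` digits of the coordinate
`v_m(n(x) g(x) / p(x))`. -/
def genMap (g : (ZMod b)[X]) : (Fin m → ZMod b) →ₗ[ZMod b] (Fin m → ZMod b) :=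
  expansion b m p ∘ₗ LinearMap.mulRight (ZMod b) g ∘ₗ vecPoly b m

variable {m p}

/-- Multiplication by `g` is invertible modulo the irreducible `p`, and a residue class is determined
by the first `deg p` coefficients of its expansion. -/
theorem genMap_bijective (hp : Irreducible p) (hdeg : p.natDegree = m) {g : (ZMod b)[X]}
    (hg : g ∈ Gstar b m) : Function.Bijective (genMap m p g) := by
  refine Finite.injective_iff_bijective.mp ((injective_iff_map_eq_zero _).mpr fun c hc => ?_)
  have hlt : ∀ q : (ZMod b)[X], q.degree < m → p ∣ q → q = 0 := fun q hq hd =>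
    Polynomial.eq_zero_of_dvd_of_degree_lt hd
      (by rwa [Polynomial.degree_eq_natDegree hp.ne_zero, hdeg])
  rcases hp.prime.dvd_or_dvd (dvd_of_expansion_eq_zero hp.ne_zero hdeg hc) with h | h
  · ext i
    rw [← vecPoly_coeff c i, hlt _ (vecPoly_degree_lt c) h]
    simp
  · exact absurd (hlt g hg.2 h) hg.1

end

/-! ### Finite base `b` expansions -/

/-- The real number with base `b` digits `a 0, …, a (m - 1)` after the point. -/
def digitReal (b m : ℕ) (a : ℕ → ℕ) : ℝ :=
  ∑ l ∈ Finset.range m, (a l : ℝ) * ((b : ℝ) ^ (l + 1))⁻¹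

theorem digitReal_succ {b : ℕ} (m : ℕ) (a : ℕ → ℕ) :
    digitReal b (m + 1) a = (a 0 + digitReal b m fun l => a (l + 1)) / b := by
  unfold digitReal
  rw [Finset.sum_range_succ', add_comm, add_div, Finset.sum_div]
  congr 1
  · simp [div_eq_mul_inv]
  · refine Finset.sum_congr rfl fun l _ => ?_
    rw [pow_succ _ (l + 1), mul_inv, div_eq_mul_inv, mul_assoc]

theorem digitReal_nonneg (b m : ℕ) (a : ℕ → ℕ) : 0 ≤ digitReal b m a :=
  Finset.sum_nonneg fun _ _ => by positivity

theorem digitReal_lt_one {b : ℕ} (hb : 0 < b) (m : ℕ) {a : ℕ → ℕ} (ha : ∀ l, a l < b) :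
    digitReal b m a < 1 := by
  induction m generalizing a with
  | zero => simp [digitReal]
  | succ m ih =>
    have hb' : (0 : ℝ) < b := by exact_mod_cast hb
    rw [digitReal_succ, div_lt_one hb']
    have h1 : (a 0 : ℝ) + 1 ≤ b := by exact_mod_cast ha 0
    linarith [ih fun l => ha (l + 1)]

theorem realDigit_digitReal {b : ℕ} (hb : 0 < b) (m : ℕ) {a : ℕ → ℕ} (ha : ∀ l, a l < b) (i : ℕ) :
    realDigit b (digitReal b m a) i = if i < m then a i else 0 := by
  have hb' : (b : ℝ) ≠ 0 := by exact_mod_cast hb.ne'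
  induction i generalizing a m with
  | zero =>
    cases m with
    | zero => simp [realDigit, digitReal]
    | succ m =>
      unfold realDigit
      rw [digitReal_succ, zero_add, pow_one, div_mul_cancel₀ _ hb', add_comm,
        Nat.floor_add_natCast (digitReal_nonneg _ _ _),
        Nat.floor_eq_zero.mpr (digitReal_lt_one hb m fun l => ha (l + 1))]
      simp [Nat.mod_eq_of_lt (ha 0)]
  | succ i ih =>
    cases m with
    | zero => simp [realDigit, digitReal]
    | succ m =>
      have h := ih m fun l => ha (l + 1)
      unfold realDigit at h ⊢
      have h1 : digitReal b (m + 1) a * (b : ℝ) ^ (i + 1 + 1) =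
          digitReal b m (fun l => a (l + 1)) * (b : ℝ) ^ (i + 1) + (a 0 * b ^ (i + 1) : ℕ) := by
        rw [digitReal_succ]
        push_cast
        field_simp
        ring
      rw [h1, Nat.floor_add_natCast (by have := digitReal_nonneg b m fun l => a (l + 1); positivity)]
      rw [show a 0 * b ^ (i + 1) = a 0 * b ^ i * b by ring, Nat.add_mul_mod_self_right, h]
      simp

theorem inv_pow_le_digitReal {b m : ℕ} {a : ℕ → ℕ} {i : ℕ} (hi : i < m) (h0 : a i ≠ 0) :
    ((b : ℝ) ^ (i + 1))⁻¹ ≤ digitReal b m a := by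
  refine le_trans ?_ (Finset.single_le_sum
    (f := fun l => (a l : ℝ) * ((b : ℝ) ^ (l + 1))⁻¹) (fun _ _ => by positivity)
    (Finset.mem_range.mpr hi))
  have h1 : (1 : ℝ) ≤ a i := by exact_mod_cast Nat.one_le_iff_ne_zero.mpr h0
  exact le_mul_of_one_le_left (by positivity) h1

theorem digitReal_lt_inv_pow {b : ℕ} (hb : 0 < b) {m : ℕ} {a : ℕ → ℕ} (ha : ∀ l, a l < b) {i : ℕ}
    (h0 : ∀ l < i, a l = 0) : digitReal b m a < ((b : ℝ) ^ i)⁻¹ := by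
  have hb' : (0 : ℝ) < b := by exact_mod_cast hb
  induction i generalizing a m with
  | zero => simpa using digitReal_lt_one hb m ha
  | succ i ih =>
    cases m with
    | zero => simp only [digitReal, Finset.range_zero, Finset.sum_empty]; positivity
    | succ m =>
      have h1 := ih (m := m) (fun l => ha (l + 1)) fun l hl => h0 (l + 1) (by omega)
      rw [digitReal_succ, h0 0 (by omega), Nat.cast_zero, zero_add, pow_succ, mul_inv,
        ← div_eq_mul_inv]
      exact div_lt_div_of_pos_right h1 hb'

theorem floor_logb_digitReal {b : ℕ} (hb : 1 < b) {m : ℕ} {a : ℕ → ℕ} (ha : ∀ l, a l < b) {i : ℕ}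
    (hi : i < m) (hne : a i ≠ 0) (h0 : ∀ l < i, a l = 0) :
    ⌊Real.logb b (digitReal b m a)⌋ = -((i : ℤ) + 1) := by
  have hb' : (1 : ℝ) < b := by exact_mod_cast hb
  have hle := inv_pow_le_digitReal (b := b) hi hne
  have hpos : 0 < digitReal b m a := lt_of_lt_of_le (by positivity) hle
  have hlt := digitReal_lt_inv_pow (m := m) (by omega) ha h0
  rw [Int.floor_eq_iff]
  constructor
  · rw [Real.le_logb_iff_rpow_le hb' hpos, Real.rpow_intCast, zpow_neg]
    exact_mod_cast hle
  · rw [Real.logb_lt_iff_lt_rpow hb' hpos]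
    have : ((-((i : ℤ) + 1) : ℤ) : ℝ) + 1 = ((-(i : ℤ) : ℤ) : ℝ) := by push_cast; ring
    rw [this, Real.rpow_intCast, zpow_neg]
    exact_mod_cast hlt

section
variable {b : ℕ} [Fact b.Prime] {m : ℕ}

/-- The sequence of representatives in `{0, …, b - 1}` of a vector of digits, continued by `0`. -/
def vecDigits (ξ : Fin m → ZMod b) (l : ℕ) : ℕ := if h : l < m then (ξ ⟨l, h⟩).val else 0

theorem vecDigits_lt (ξ : Fin m → ZMod b) (l : ℕ) : vecDigits ξ l < b := by
  unfold vecDigits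
  split_ifs
  · exact ZMod.val_lt _
  · exact (Fact.out : b.Prime).pos

theorem latticeCoord_eq {p g : (ZMod b)[X]} {n : ℕ} (hn : n < b ^ m) :
    latticeCoord b m p g n = digitReal b m (vecDigits (genMap m p g (digitVec b m n))) := by
  unfold latticeCoord vMap digitReal
  rw [← Finset.Ico_add_one_right_eq_Icc, Finset.sum_Ico_eq_sum_range, Nat.add_sub_cancel]
  refine Finset.sum_congr rfl fun l hl => ?_
  have hl' := Finset.mem_range.mp hl
  rw [natPoly_eq hn, ← toSeries_mul, add_comm 1 l, vecDigits, dif_pos hl']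
  simp [genMap, expansion]

/-! ### Walsh characters -/

/-- The value of the `k`-th Walsh function at a point with the digits `ξ`. -/
def walChar (k : ℕ) (ξ : Fin m → ZMod b) : ℂ := ZMod.stdAddChar (digitVec b m k ⬝ᵥ ξ)

theorem wal_digitReal (k : ℕ) (ξ : Fin m → ZMod b) :
    wal b k (digitReal b m (vecDigits ξ)) = walChar k ξ := by
  have hb := (Fact.out : b.Prime)
  unfold wal walChar
  set S := ∑ i ∈ Finset.range (natLen b k),
    natDigit b k i * realDigit b (digitReal b m (vecDigits ξ)) i with hS
  have h1 : S = ∑ i : Fin m, natDigit b k i * (ξ i).val := by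
    rw [hS, Finset.sum_subset (Finset.range_subset_range.mpr (le_max_left (natLen b k) m)),
      ← Finset.sum_subset (Finset.range_subset_range.mpr (le_max_right (natLen b k) m)),
      Finset.sum_range]
    · refine Finset.sum_congr rfl fun i _ => ?_
      rw [realDigit_digitReal hb.pos m (vecDigits_lt ξ), if_pos i.2, vecDigits, dif_pos i.2]
    · intro i _ hi
      rw [realDigit_digitReal hb.pos m (vecDigits_lt ξ), if_neg (by simpa using hi), mul_zero]
    · intro i _ hi
      rw [natDigit_eq_zero_of_natLen_le hb.one_lt (by simpa using hi), zero_mul]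
  have h2 : digitVec b m k ⬝ᵥ ξ = ((S : ℤ) : ZMod b) := by
    rw [h1]
    push_cast
    simp [dotProduct, digitVec]
  rw [h2, ZMod.stdAddChar_coe]
  push_cast
  rfl

theorem sum_range_stdAddChar_mul (x : ZMod b) :
    ∑ c ∈ Finset.range b, (ZMod.stdAddChar ((c : ZMod b) * x) : ℂ) = if x = 0 then (b : ℂ) else 0 := by
  have h : ∑ c ∈ Finset.range b, (ZMod.stdAddChar ((c : ZMod b) * x) : ℂ) =
      ∑ c : ZMod b, (ZMod.stdAddChar (c * x) : ℂ) := by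
    refine Finset.sum_bij' (fun c _ => (c : ZMod b)) (fun c _ => c.val) ?_ ?_ ?_ ?_ ?_
    · simp
    · intro c _; simpa using ZMod.val_lt c
    · intro c hc
      rw [ZMod.val_natCast, Nat.mod_eq_of_lt (Finset.mem_range.mp hc)]
    · intro c _; simp
    · simp
  rw [h, AddChar.sum_mulShift x (ZMod.isPrimitive_stdAddChar b), ZMod.card]
  split_ifs <;> simp

theorem natDigit_add_pow_mul {a r c : ℕ} (hr : r < b ^ a) (hc : c < b) (i : ℕ) :
    natDigit b (r + b ^ a * c) i = natDigit b r i + if i = a then c else 0 := by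
  have hb := (Fact.out : b.Prime).pos
  unfold natDigit
  rcases lt_trichotomy i a with h | h | h
  · rw [if_neg h.ne, add_zero]
    obtain ⟨e, rfl⟩ : ∃ e, a = i + (e + 1) := ⟨a - i - 1, by omega⟩
    have : b ^ (i + (e + 1)) * c = b ^ i * (b * (b ^ e * c)) := by ring
    rw [this, Nat.add_mul_div_left _ _ (by positivity), Nat.add_mul_mod_self_left]
  · subst h
    rw [if_pos rfl, Nat.add_mul_div_left _ _ (by positivity), Nat.div_eq_of_lt hr]
    simp [Nat.mod_eq_of_lt hc]
  · rw [if_neg h.ne', add_zero]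
    have h1 : b ^ (a + 1) ≤ b ^ i := Nat.pow_le_pow_right hb h
    have h2 : r + b ^ a * c < b ^ (a + 1) := by
      calc r + b ^ a * c < b ^ a * (c + 1) := by rw [mul_add]; omega
        _ ≤ b ^ a * b := Nat.mul_le_mul_left _ hc
    rw [Nat.div_eq_of_lt (by omega), Nat.div_eq_of_lt (by omega)]

/-- The Dirichlet kernel of the Walsh system: the characters `k < b ^ a` are those of the first `a`
digits. -/
theorem sum_walChar_range_pow {a : ℕ} (ha : a ≤ m) (ξ : Fin m → ZMod b) :
    ∑ k ∈ Finset.range (b ^ a), walChar k ξ =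
      if ∀ i : Fin m, (i : ℕ) < a → ξ i = 0 then (b : ℂ) ^ a else 0 := by
  induction a with
  | zero => simp [walChar, digitVec_zero]
  | succ a ih =>
    rw [sum_range_pow_succ]
    have h1 : ∀ c ∈ Finset.range b, ∀ r ∈ Finset.range (b ^ a), walChar (r + b ^ a * c) ξ =
        ZMod.stdAddChar ((c : ZMod b) * ξ ⟨a, ha⟩) * walChar r ξ := by
      intro c hc r hr
      rw [Finset.mem_range] at hc hr
      unfold walChar
      rw [← AddChar.map_add_eq_mul]
      congr 1
      have : digitVec b m (r + b ^ a * c) = Pi.single ⟨a, ha⟩ (c : ZMod b) + digitVec b m r := by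
        ext i
        simp only [digitVec, natDigit_add_pow_mul hr hc, Pi.add_apply, Pi.single_apply, Fin.ext_iff]
        push_cast
        rw [add_comm]
      rw [this, add_dotProduct, single_dotProduct]
    rw [Finset.sum_congr rfl fun c hc => Finset.sum_congr rfl (h1 c hc)]
    simp_rw [← Finset.mul_sum]
    rw [← Finset.sum_mul, ih (by omega), sum_range_stdAddChar_mul]
    by_cases hx : ξ ⟨a, ha⟩ = 0
    · have : (∀ i : Fin m, (i : ℕ) < a + 1 → ξ i = 0) ↔ ∀ i : Fin m, (i : ℕ) < a → ξ i = 0 := by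
        refine ⟨fun h i hi => h i (by omega), fun h i hi => ?_⟩
        rcases Nat.lt_succ_iff_lt_or_eq.mp hi with h2 | h2
        · exact h i h2
        · rw [show i = ⟨a, ha⟩ from Fin.ext h2, hx]
      rw [if_pos hx]
      simp only [this]
      split_ifs <;> simp [pow_succ, mul_comm]
    · rw [if_neg hx, zero_mul, if_neg]
      exact fun h => hx (h _ (Nat.lt_succ_self a))

theorem sum_Ico_one_pow {M : Type*} [AddCommMonoid M] (F : ℕ → M) (m : ℕ) :
    ∑ k ∈ Finset.Ico 1 (b ^ m), F k =
      ∑ a ∈ Finset.range m, ∑ k ∈ Finset.Ico (b ^ a) (b ^ (a + 1)), F k := by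
  have hb := (Fact.out : b.Prime).pos
  induction m with
  | zero => simp
  | succ m ih =>
    rw [Finset.sum_range_succ, ← ih, Finset.sum_Ico_consecutive F (Nat.one_le_pow _ _ hb)
      (Nat.pow_le_pow_right hb (Nat.le_succ m))]

theorem decay_of_mem_Ico (α : ℝ) {a k : ℕ} (hk : k ∈ Finset.Ico (b ^ a) (b ^ (a + 1))) :
    decay b α k = (b : ℝ) ^ (α * a) := by
  have hb := (Fact.out : b.Prime)
  rw [Finset.mem_Ico] at hk
  have h0 : k ≠ 0 := by have := Nat.one_le_pow a b hb.pos; omega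
  rw [decay, if_neg h0, (Nat.log_eq_iff (Or.inr ⟨hb.one_lt, h0⟩)).mpr hk]

/-- The kernel `∑ wal_k / r_1(k)`, over `1 ≤ k < b ^ m`, at a point with the digits `ξ`, in closed
form. -/
def kernelVal (ξ : Fin m → ZMod b) : ℝ :=
  if ξ = 0 then m * ((b : ℝ) - 1)
  else (1 - (b : ℝ)) * (⌊Real.logb b (digitReal b m (vecDigits ξ))⌋ : ℝ) - b

theorem sum_decay_walChar (ξ : Fin m → ZMod b) :
    ∑ k ∈ Finset.Ico 1 (b ^ m), ((decay b 1 k)⁻¹ : ℝ) * walChar k ξ = (kernelVal ξ : ℂ) := by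
  have hb := (Fact.out : b.Prime)
  have hb0 : (b : ℂ) ≠ 0 := by exact_mod_cast hb.ne_zero
  set P : ℕ → Prop := fun a => ∀ i : Fin m, (i : ℕ) < a → ξ i = 0 with hP
  classical
  -- On each block `b ^ a ≤ k < b ^ (a + 1)`, where `r_1` is constant, the sum is a difference of two
  -- Dirichlet kernels.
  have h1 : ∑ k ∈ Finset.Ico 1 (b ^ m), ((decay b 1 k)⁻¹ : ℝ) * walChar k ξ =
      ∑ a ∈ Finset.range m, ((if P (a + 1) then (b : ℂ) else 0) - if P a then 1 else 0) := by
    rw [sum_Ico_one_pow]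
    refine Finset.sum_congr rfl fun a ha => ?_
    rw [Finset.mem_range] at ha
    have h2 : ∀ k ∈ Finset.Ico (b ^ a) (b ^ (a + 1)), ((decay b 1 k)⁻¹ : ℝ) * walChar k ξ =
        ((b : ℂ) ^ a)⁻¹ * walChar k ξ := by
      intro k hk
      rw [decay_of_mem_Ico 1 hk, one_mul, Real.rpow_natCast]
      push_cast
      rfl
    rw [Finset.sum_congr rfl h2, ← Finset.mul_sum,
      Finset.sum_Ico_eq_sub _ (Nat.pow_le_pow_right hb.pos (Nat.le_succ a)),
      sum_walChar_range_pow (by omega), sum_walChar_range_pow (by omega), mul_sub]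
    have h3 : ((b : ℂ) ^ a)⁻¹ * (b : ℂ) ^ (a + 1) = b := by
      rw [pow_succ, inv_mul_cancel_left₀ (pow_ne_zero _ hb0)]
    have h4 : ((b : ℂ) ^ a)⁻¹ * (b : ℂ) ^ a = 1 := inv_mul_cancel₀ (pow_ne_zero _ hb0)
    congr 1
    · rw [mul_ite, mul_zero, h3]
    · rw [mul_ite, mul_zero, h4]
  rw [h1, kernelVal]
  split_ifs with h0
  · have : ∀ a, P a := fun a i _ => by rw [h0]; rfl
    simp [this, mul_sub]
  · have hex : ∃ i, ∃ h : i < m, ξ ⟨i, h⟩ ≠ 0 := by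
      by_contra! hcon
      exact h0 (funext fun i => hcon i i.2)
    classical
    obtain ⟨him, hi⟩ := Nat.find_spec hex
    set i := Nat.find hex with hidef
    have hmin : ∀ l < i, ∀ h : l < m, ξ ⟨l, h⟩ = 0 := by
      intro l hl h
      by_contra hne
      exact Nat.find_min hex hl ⟨h, hne⟩
    have hPa : ∀ a, P a ↔ a ≤ i := by
      refine fun a => ⟨fun h => ?_, fun h l hl => hmin l (by omega) l.2⟩
      by_contra! hlt
      exact hi (h ⟨i, him⟩ hlt)
    rw [floor_logb_digitReal hb.one_lt (vecDigits_lt ξ) him]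
    · simp only [hPa]
      rw [Finset.sum_sub_distrib, ← Finset.sum_filter, ← Finset.sum_filter, Finset.sum_const,
        Finset.sum_const]
      have e1 : (Finset.range m).filter (fun a => a + 1 ≤ i) = Finset.range i := by
        ext a; simp; omega
      have e2 : (Finset.range m).filter (fun a => a ≤ i) = Finset.range (i + 1) := by
        ext a; simp; omega
      rw [e1, e2]
      simp only [Finset.card_range]
      push_cast
      simp only [nsmul_eq_mul]
      push_cast
      ring
    · rw [vecDigits, dif_pos him]
      exact (ZMod.val_ne_zero _).mpr hi
    · intro l hl
      unfold vecDigits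
      split_ifs with h
      · simp [hmin l hl h]
      · rfl

end

section
variable {b : ℕ} [Fact b.Prime]

/-! ### The dual lattice -/

/-- The dual lattice of the polynomial lattice, described as the set of those `k` whose Walsh function
is trivial on all points. The condition involves only the first `m` digits of each `k j`. -/
def InDual (m : ℕ) (p : (ZMod b)[X]) {d : ℕ} (g : Fin d → (ZMod b)[X]) (k : Fin d → ℕ) : Prop :=
  ∀ c : Fin m → ZMod b, ∑ j, digitVec b m (k j) ⬝ᵥ genMap m p (g j) c = 0

variable {m : ℕ} {p : (ZMod b)[X]} {d : ℕ}

open Classical in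
theorem sum_prod_walChar (g : Fin d → (ZMod b)[X]) (k : Fin d → ℕ) :
    ∑ c, ∏ j, walChar (k j) (genMap m p (g j) c) = if InDual m p g k then (b : ℂ) ^ m else 0 := by
  let φ : (Fin m → ZMod b) →+ ZMod b :=
    AddMonoidHom.mk' (fun c => ∑ j, digitVec b m (k j) ⬝ᵥ genMap m p (g j) c) fun x y => by
      simp [dotProduct_add, Finset.sum_add_distrib]
  have h1 : ∀ c, ∏ j, walChar (k j) (genMap m p (g j) c) =
      (ZMod.stdAddChar (N := b)).compAddMonoidHom φ c := fun c => by
    unfold walChar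
    rw [AddChar.compAddMonoidHom_apply]
    exact (map_prod (ZMod.stdAddChar (N := b)).toMonoidHom
      (fun j => Multiplicative.ofAdd (digitVec b m (k j) ⬝ᵥ genMap m p (g j) c)) Finset.univ).symm
  have h2 : (ZMod.stdAddChar (N := b)).compAddMonoidHom φ = 0 ↔ InDual m p g k := by
    constructor
    · intro h c
      have h3 := DFunLike.congr_fun h c
      rw [AddChar.compAddMonoidHom_apply, AddChar.zero_apply,
        ← AddChar.map_zero_eq_one (ZMod.stdAddChar (N := b))] at h3
      exact ZMod.injective_stdAddChar h3
    · intro h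
      ext c
      rw [AddChar.compAddMonoidHom_apply, show φ c = 0 from h c]
      simp
  simp_rw [h1]
  rw [AddChar.sum_eq_ite]
  simp [h2]

/-- Two elements of the dual lattice that agree in all coordinates but `j` agree in the first `m`
digits of the coordinate `j` as well. -/
theorem InDual.mod_eq (hp : Irreducible p) (hdeg : p.natDegree = m) {g : Fin d → (ZMod b)[X]}
    {k l : Fin d → ℕ} (hk : InDual m p g k) (hl : InDual m p g l) {j : Fin d}
    (hj : g j ∈ Gstar b m) (h : ∀ i, i ≠ j → k i = l i) : k j % b ^ m = l j % b ^ m := by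
  refine mod_pow_eq_of_digitVec_eq (sub_eq_zero.mp (dotProduct_eq_zero _ fun ξ => ?_))
  obtain ⟨c, rfl⟩ := (genMap_bijective hp hdeg hj).2 ξ
  have h1 : ∑ i, (digitVec b m (k i) - digitVec b m (l i)) ⬝ᵥ genMap m p (g i) c = 0 := by
    simp only [sub_dotProduct, Finset.sum_sub_distrib]
    rw [hk c, hl c, sub_zero]
  rwa [Finset.sum_eq_single j] at h1
  · intro i _ hi
    rw [h i hi, sub_self, zero_dotProduct]
  · simp

theorem decay_pos (α : ℝ) (k : ℕ) : 0 < decay b α k := by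
  have := (Fact.out : b.Prime).pos
  unfold decay
  split_ifs <;> positivity

theorem decay_zero (b : ℕ) (α : ℝ) : decay b α 0 = 1 := if_pos rfl

/-- The vectors with support `u` and all entries less than `N`. -/
def suppBox (N : ℕ) (u : Finset (Fin d)) : Finset (Fin d → ℕ) :=
  Fintype.piFinset fun j => if j ∈ u then Finset.Ico 1 N else {0}

open Classical in
/-- The part of the dual lattice with support `u` and entries less than `b ^ m`, weighted by `1 / r_1`,
as a sum over the points. -/
theorem sum_prod_kernelVal (g : Fin d → (ZMod b)[X]) (u : Finset (Fin d)) :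
    ∑ c, ∏ j ∈ u, kernelVal (genMap m p (g j) c) =
      (b : ℝ) ^ m * ∑ k ∈ suppBox (b ^ m) u with InDual m p g k, ∏ j, (decay b 1 (k j))⁻¹ := by
  have h1 : ∀ c, ((∏ j ∈ u, kernelVal (genMap m p (g j) c) : ℝ) : ℂ) =
      ∑ k ∈ suppBox (b ^ m) u, ((∏ j, (decay b 1 (k j))⁻¹ : ℝ) : ℂ) *
        ∏ j, walChar (k j) (genMap m p (g j) c) := by
    intro c
    have h2 : ∀ j, (if j ∈ u then (kernelVal (genMap m p (g j) c) : ℂ) else 1) =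
        ∑ k ∈ if j ∈ u then Finset.Ico 1 (b ^ m) else {0},
          ((decay b 1 k)⁻¹ : ℝ) * walChar k (genMap m p (g j) c) := by
      intro j
      split_ifs
      · exact (sum_decay_walChar _).symm
      · simp [decay_zero, walChar, digitVec_zero]
    calc ((∏ j ∈ u, kernelVal (genMap m p (g j) c) : ℝ) : ℂ)
        = ∏ j, (if j ∈ u then (kernelVal (genMap m p (g j) c) : ℂ) else 1) := by
          rw [Finset.prod_ite_mem, Finset.univ_inter]; push_cast; rfl
      _ = _ := by
          rw [Finset.prod_congr rfl fun j _ => h2 j, Finset.prod_univ_sum]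
          refine Finset.sum_congr rfl fun k _ => ?_
          rw [Finset.prod_mul_distrib]
          push_cast
          rfl
  have h3 : ((∑ c, ∏ j ∈ u, kernelVal (genMap m p (g j) c) : ℝ) : ℂ) =
      ((b ^ m * ∑ k ∈ suppBox (b ^ m) u with InDual m p g k, ∏ j, (decay b 1 (k j))⁻¹ : ℝ) : ℂ) := by
    rw [Complex.ofReal_sum, Finset.sum_congr rfl fun c _ => h1 c, Finset.sum_comm]
    simp_rw [← Finset.mul_sum, sum_prod_walChar]
    rw [Finset.sum_filter, Complex.ofReal_mul, Complex.ofReal_sum, Finset.mul_sum]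
    refine Finset.sum_congr rfl fun k _ => ?_
    split_ifs <;> push_cast <;> ring
  exact_mod_cast h3

theorem sum_prod_kernelVal_nonneg (g : Fin d → (ZMod b)[X]) (u : Finset (Fin d)) :
    0 ≤ ∑ c, ∏ j ∈ u, kernelVal (genMap m p (g j) c) := by
  classical
  rw [sum_prod_kernelVal]
  refine mul_nonneg (by positivity) (Finset.sum_nonneg fun k _ => Finset.prod_nonneg fun j _ => ?_)
  exact inv_nonneg.mpr (decay_pos _ _).le

theorem sum_kernelVal (hp : Irreducible p) (hdeg : p.natDegree = m) {g : (ZMod b)[X]}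
    (hg : g ∈ Gstar b m) : ∑ c, kernelVal (genMap m p g c) = 0 := by
  classical
  have h := sum_prod_kernelVal (m := m) (p := p) (d := 1) (fun _ => g) Finset.univ
  simp only [Finset.univ_unique, Finset.prod_singleton] at h
  rw [h, Finset.filter_false_of_mem, Finset.sum_empty, mul_zero]
  intro k hk hdual
  have h0 : InDual m p (d := 1) (fun _ => g) fun _ => 0 := fun c => by simp [digitVec_zero]
  have h1 := hdual.mod_eq hp hdeg h0 (j := 0) hg fun i hi => absurd (Subsingleton.elim i 0) hi
  have h2 := Fintype.mem_piFinset.mp hk 0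
  simp only [Finset.mem_singleton, Fin.default_eq_zero, if_true, Finset.mem_Ico] at h2
  rw [Nat.mod_eq_of_lt h2.2, Nat.zero_mod] at h1
  omega

/-! ### The quality function -/

variable (b) in
/-- The factor of the quality function that belongs to the generator `g` and the `n`-th point. -/
def qualityFactor (m : ℕ) (p g : (ZMod b)[X]) (n : ℕ) : ℝ :=
  (1 - (b : ℝ)) * (⌊Real.logb b (latticeCoord b m p g n)⌋ : ℝ) - b

theorem qualityFactor_eq (hp : Irreducible p) (hdeg : p.natDegree = m) {g : (ZMod b)[X]}
    (hg : g ∈ Gstar b m) {n : ℕ} (h0 : n ≠ 0) (hn : n < b ^ m) :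
    qualityFactor b m p g n = kernelVal (genMap m p g (digitVec b m n)) := by
  have h : genMap m p g (digitVec b m n) ≠ 0 := by
    rw [← map_zero (genMap m p g)]
    exact (genMap_bijective hp hdeg hg).1.ne (digitVec_ne_zero h0 hn)
  rw [qualityFactor, kernelVal, if_neg h, latticeCoord_eq hn]

/-- Exchanging the roles of the point and the generator turns the sum over the candidates for a
component into a sum over the points. -/
theorem qualityFactor_comm {n l : ℕ} :
    qualityFactor b m p (natPoly b l) n = qualityFactor b m p (natPoly b n) l := by
  unfold qualityFactor latticeCoord
  rw [mul_comm (toSeries b (natPoly b n))]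

theorem sum_Icc_digitVec (F : (Fin m → ZMod b) → ℝ) :
    ∑ n ∈ Finset.Icc 1 (b ^ m - 1), F (digitVec b m n) = ∑ c, F c - F 0 := by
  have hN : 0 < b ^ m := Nat.pow_pos (Fact.out : b.Prime).pos
  rw [← sum_digitVec, ← Finset.Ico_add_one_right_eq_Icc,
    Nat.sub_add_cancel (Nat.one_le_iff_ne_zero.mpr hN.ne'), Finset.range_eq_Ico,
    Finset.sum_eq_sum_Ico_succ_bot hN, digitVec_zero]
  ring

theorem kernelVal_zero : kernelVal (0 : Fin m → ZMod b) = m * ((b : ℝ) - 1) := if_pos rfl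

theorem sum_prod_qualityFactor (hp : Irreducible p) (hdeg : p.natDegree = m)
    {g : Fin d → (ZMod b)[X]} (hg : ∀ j, g j ∈ Gstar b m) (u : Finset (Fin d)) :
    ∑ n ∈ Finset.Icc 1 (b ^ m - 1), ∏ j ∈ u, qualityFactor b m p (g j) n =
      ∑ c, ∏ j ∈ u, kernelVal (genMap m p (g j) c) - (m * ((b : ℝ) - 1)) ^ u.card := by
  have h := sum_Icc_digitVec (b := b) fun c => ∏ j ∈ u, kernelVal (genMap m p (g j) c)
  simp only [map_zero, kernelVal_zero, Finset.prod_const] at h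
  rw [← h]
  refine Finset.sum_congr rfl fun n hn => Finset.prod_congr rfl fun j _ => ?_
  rw [Finset.mem_Icc] at hn
  exact qualityFactor_eq hp hdeg (hg j) (by omega) (by omega)

theorem sum_qualityFactor (hp : Irreducible p) (hdeg : p.natDegree = m) {g : (ZMod b)[X]}
    (hg : g ∈ Gstar b m) :
    ∑ n ∈ Finset.Icc 1 (b ^ m - 1), qualityFactor b m p g n = -(m * ((b : ℝ) - 1)) := by
  have h := sum_prod_qualityFactor hp hdeg (d := 1) (g := fun _ => g) (fun _ => hg) Finset.univ
  simpa [sum_kernelVal hp hdeg hg] using h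

end

theorem sum_powerset_range {M : Type*} [AddCommMonoid M] (d : ℕ) (F : Finset ℕ → M) :
    ∑ u ∈ (Finset.range d).powerset, F u = ∑ u : Finset (Fin d), F (u.map Fin.valEmbedding) := by
  have h : (Finset.range d).powerset =
      (Finset.univ : Finset (Finset (Fin d))).map (Finset.mapEmbedding Fin.valEmbedding).toEmbedding := by
    ext u
    rw [Finset.mem_powerset, ← Finset.coe_subset, Finset.mem_map]
    have h1 : Finset.range d = (Finset.univ : Finset (Fin d)).map Fin.valEmbedding := by
      ext; simp
    rw [h1, Finset.coe_subset, Finset.subset_map_iff]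
    constructor
    · rintro ⟨v, _, rfl⟩
      exact ⟨v, Finset.mem_univ _, rfl⟩
    · rintro ⟨v, _, rfl⟩
      exact ⟨v, Finset.subset_univ _, rfl⟩
  rw [h, Finset.sum_map]
  rfl

theorem sum_powerset_range_succ (s : ℕ) (F : Finset ℕ → ℝ) :
    ∑ u ∈ (Finset.range (s + 1)).powerset, F u =
      ∑ u ∈ (Finset.range s).powerset, F u + ∑ u ∈ (Finset.range s).powerset, F (insert s u) := by
  rw [Finset.range_add_one, Finset.sum_powerset_insert Finset.notMem_range_self]

/-- `∑ η_u (m (b - 1)) ^ |u|`, over the subsets `u` of the first `s` coordinates, including `∅`. -/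
def kernelBound (b : ℕ) (η : Finset ℕ → ℝ) (m s : ℕ) : ℝ :=
  ∑ u ∈ (Finset.range s).powerset, η u * (m * ((b : ℝ) - 1)) ^ u.card

theorem kernelBound_succ (b : ℕ) (η : Finset ℕ → ℝ) (m s : ℕ) :
    kernelBound b η m (s + 1) = kernelBound b η m s +
      ∑ u : Finset (Fin s), η (insert s (u.map Fin.valEmbedding)) *
        (m * ((b : ℝ) - 1)) ^ (u.card + 1) := by
  unfold kernelBound
  rw [sum_powerset_range_succ]
  congr 1
  rw [sum_powerset_range]
  refine Finset.sum_congr rfl fun u _ => ?_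
  rw [Finset.card_insert_of_notMem (by simp +contextual [Fin.is_lt, ne_of_lt]), Finset.card_map]

section
variable {b : ℕ} [Fact b.Prime] {m : ℕ} {p : (ZMod b)[X]}

theorem quality_eq_sum (η : Finset ℕ → ℝ) {s : ℕ} (g : Fin s → (ZMod b)[X]) :
    quality b η m p g = ∑ u : Finset (Fin s), η (u.map Fin.valEmbedding) *
        ∑ n ∈ Finset.Icc 1 (b ^ m - 1), ∏ j ∈ u, qualityFactor b m p (g j) n -
      η ∅ * ((b : ℝ) ^ m - 1) := by
  have hN : 1 ≤ b ^ m := Nat.one_le_pow _ _ (Fact.out : b.Prime).pos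
  unfold quality
  rw [Finset.powerset_univ, eq_sub_iff_add_eq,
    ← Finset.sum_erase_add (a := (∅ : Finset (Fin s))) _ _ (Finset.mem_univ _)]
  simp [qualityFactor, Nat.cast_sub hN]

theorem quality_snoc (η : Finset ℕ → ℝ) {s : ℕ} (g : Fin s → (ZMod b)[X]) (h : (ZMod b)[X]) :
    quality b η m p (Fin.snoc (α := fun _ => (ZMod b)[X]) g h) = quality b η m p g +
      ∑ u : Finset (Fin s), η (insert s (u.map Fin.valEmbedding)) *
        ∑ n ∈ Finset.Icc 1 (b ^ m - 1),
          (∏ j ∈ u, qualityFactor b m p (g j) n) * qualityFactor b m p h n := by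
  set G : ℕ → (ZMod b)[X] := fun j => if hj : j < s then g ⟨j, hj⟩ else h with hG
  have hGs : G s = h := by simp [hG]
  have hGj : ∀ j : Fin s, G j = g j := fun j => by simp [hG]
  have hsn : ∀ j : Fin (s + 1), (Fin.snoc (α := fun _ => (ZMod b)[X]) g h) j = G j := by
    intro j
    refine Fin.lastCases ?_ (fun i => ?_) j
    · rw [Fin.snoc_last, Fin.val_last, hGs]
    · rw [Fin.snoc_castSucc, Fin.val_castSucc, hGj]
  set F : Finset ℕ → ℝ := fun u => η u *
    ∑ n ∈ Finset.Icc 1 (b ^ m - 1), ∏ j ∈ u, qualityFactor b m p (G j) n with hF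
  have h1 := sum_powerset_range_succ s F
  have h2 : ∑ u ∈ (Finset.range s).powerset, F (insert s u) = ∑ u ∈ (Finset.range s).powerset,
      η (insert s u) * ∑ n ∈ Finset.Icc 1 (b ^ m - 1),
        (∏ j ∈ u, qualityFactor b m p (G j) n) * qualityFactor b m p h n := by
    refine Finset.sum_congr rfl fun u hu => ?_
    have hs : s ∉ u := fun hs => by simpa using Finset.mem_powerset.mp hu hs
    simp only [hF]
    congr 1
    refine Finset.sum_congr rfl fun n _ => ?_
    rw [Finset.prod_insert hs, hGs, mul_comm]
  rw [h2, sum_powerset_range, sum_powerset_range, sum_powerset_range] at h1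
  simp only [hF, Finset.prod_map, Fin.valEmbedding_apply, hGj] at h1
  rw [quality_eq_sum, quality_eq_sum]
  simp only [hsn]
  rw [h1]
  ring

/-! ### The component-by-component algorithm -/

theorem one_lt_pow_card (hm : m ≠ 0) : (1 : ℝ) < (b : ℝ) ^ m :=
  one_lt_pow₀ (by exact_mod_cast (Fact.out : b.Prime).one_lt) hm

theorem kernelFactor_nonneg (b m : ℕ) [Fact b.Prime] : 0 ≤ m * ((b : ℝ) - 1) := by
  have : (1 : ℝ) ≤ b := by exact_mod_cast (Fact.out : b.Prime).one_le
  exact mul_nonneg (Nat.cast_nonneg _) (by linarith)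

theorem CBC.mem_Gstar {η : Finset ℕ → ℝ} (hm : m ≠ 0) {s : ℕ} {g : Fin s → (ZMod b)[X]}
    (h : CBC b η m p s g) (j : Fin s) : g j ∈ Gstar b m := by
  induction h with
  | first => exact ⟨one_ne_zero, by rw [Polynomial.degree_one]; exact_mod_cast Nat.pos_of_ne_zero hm⟩
  | step s g h hg hh hmin ih =>
    refine Fin.lastCases ?_ (fun i => ?_) j
    · rwa [Fin.snoc_last]
    · rw [Fin.snoc_castSucc]; exact ih i

theorem finite_Gstar (b m : ℕ) [Fact b.Prime] : (Gstar b m).Finite := by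
  refine (Set.finite_range (vecPoly b m)).subset fun g hg => ⟨fun i => g.coeff i, ?_⟩
  ext k
  by_cases hk : k < m
  · exact vecPoly_coeff _ ⟨k, hk⟩
  · have h1 := Polynomial.degree_lt_iff_coeff_zero _ _ |>.mp hg.2 k (by omega)
    rw [h1]
    exact Polynomial.degree_lt_iff_coeff_zero _ _ |>.mp (vecPoly_degree_lt _) k (by omega)

theorem exists_CBC (η : Finset ℕ → ℝ) (hm : m ≠ 0) {d : ℕ} (hd : 1 ≤ d) :
    ∃ g, CBC b η m p d g := by
  induction d, hd using Nat.le_induction with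
  | base => exact ⟨_, CBC.first⟩
  | succ s _ ih =>
    obtain ⟨g, hg⟩ := ih
    have hne : (Gstar b m).Nonempty := ⟨1, one_ne_zero, by
      rw [Polynomial.degree_one]; exact_mod_cast Nat.pos_of_ne_zero hm⟩
    obtain ⟨h, hh, hmin⟩ := (Gstar b m).exists_min_image
      (fun h => quality b η m p (Fin.snoc (α := fun _ => (ZMod b)[X]) g h)) (finite_Gstar b m) hne
    exact ⟨_, CBC.step s g h hg hh hmin⟩

/-- A lower bound `x` for the increments of all candidates for the next component is at most their
average, which is bounded since, for each `n ≥ 1`, the factors of all candidates sum to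
`-m (b - 1)`. -/
theorem min_increment_le (hp : Irreducible p) (hdeg : p.natDegree = m)
    {η : Finset ℕ → ℝ} (hη : ∀ u, 0 < η u) {s : ℕ} {g : Fin s → (ZMod b)[X]}
    (hg : ∀ j, g j ∈ Gstar b m) {x : ℝ}
    (hx : ∀ h ∈ Gstar b m, x ≤ ∑ u : Finset (Fin s), η (insert s (u.map Fin.valEmbedding)) *
      ∑ n ∈ Finset.Icc 1 (b ^ m - 1),
        (∏ j ∈ u, qualityFactor b m p (g j) n) * qualityFactor b m p h n) :
    x * ((b : ℝ) ^ m - 1) ≤ ∑ u : Finset (Fin s), η (insert s (u.map Fin.valEmbedding)) *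
      (m * ((b : ℝ) - 1)) ^ (u.card + 1) := by
  have hN : 1 ≤ b ^ m := Nat.one_le_pow _ _ (Fact.out : b.Prime).pos
  have h1 := Finset.card_nsmul_le_sum (Finset.Icc 1 (b ^ m - 1)) _ x fun l hl =>
    hx (natPoly b l) (by
      rw [Finset.mem_Icc] at hl
      exact natPoly_mem_Gstar (by omega) (by omega))
  rw [Nat.card_Icc, Nat.add_sub_cancel, nsmul_eq_mul, Nat.cast_sub hN, mul_comm] at h1
  push_cast at h1
  refine h1.trans ?_
  rw [Finset.sum_comm]
  refine Finset.sum_le_sum fun u _ => ?_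
  rw [← Finset.mul_sum]
  refine mul_le_mul_of_nonneg_left ?_ (hη _).le
  rw [Finset.sum_comm]
  have h2 : ∀ n ∈ Finset.Icc 1 (b ^ m - 1), ∑ l ∈ Finset.Icc 1 (b ^ m - 1),
      (∏ j ∈ u, qualityFactor b m p (g j) n) * qualityFactor b m p (natPoly b l) n =
      -(m * ((b : ℝ) - 1)) * ∏ j ∈ u, qualityFactor b m p (g j) n := by
    intro n hn
    rw [Finset.mem_Icc] at hn
    simp_rw [qualityFactor_comm (n := n)]
    rw [← Finset.mul_sum, sum_qualityFactor hp hdeg (natPoly_mem_Gstar (by omega) (by omega)),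
      mul_comm]
  rw [Finset.sum_congr rfl h2, ← Finset.mul_sum, sum_prod_qualityFactor hp hdeg hg]
  have h3 := mul_nonneg (kernelFactor_nonneg b m) (sum_prod_kernelVal_nonneg (m := m) (p := p) g u)
  rw [pow_succ]
  linarith

/-- The first component `1` costs nothing, as its sum of factors is negative; every later step adds at
most the average over the candidates. -/
theorem CBC.quality_le (hp : Irreducible p) (hdeg : p.natDegree = m) (hm : m ≠ 0)
    {η : Finset ℕ → ℝ} (hη : ∀ u, 0 < η u) {s : ℕ} {g : Fin s → (ZMod b)[X]}
    (h : CBC b η m p s g) :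
    quality b η m p g * ((b : ℝ) ^ m - 1) ≤ kernelBound b η m s - η ∅ := by
  induction h with
  | first =>
    have h1 : (fun _ => 1 : Fin 1 → (ZMod b)[X]) =
        Fin.snoc (α := fun _ => (ZMod b)[X]) (fun j : Fin 0 => j.elim0) 1 := by
      ext j : 1
      rw [Subsingleton.elim j (Fin.last 0), Fin.snoc_last]
    have hone : (1 : (ZMod b)[X]) ∈ Gstar b m :=
      (CBC.first (η := η) (p := p)).mem_Gstar hm (0 : Fin 1)
    have h2 : quality b η m p (fun j : Fin 0 => (j.elim0 : (ZMod b)[X])) = 0 := by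
      simp [quality]
    have hk : kernelBound b η m 0 = η ∅ := by simp [kernelBound]
    rw [h1, quality_snoc, h2, kernelBound_succ, hk]
    simp only [Finset.univ_unique, Finset.sum_singleton, zero_add]
    have h3 : (default : Finset (Fin 0)) = ∅ := Subsingleton.elim _ _
    simp only [h3, Finset.prod_empty, one_mul, Finset.map_empty, Finset.card_empty, zero_add, pow_one]
    rw [sum_qualityFactor hp hdeg hone]
    have h4 := mul_nonneg (hη (insert 0 ∅)).le (kernelFactor_nonneg b m)
    have h5 := mul_nonneg h4 (sub_nonneg.mpr (one_lt_pow_card (b := b) hm).le)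
    linarith
  | step s g h hg hh hmin ih =>
    rw [quality_snoc, kernelBound_succ, add_mul]
    have h1 := min_increment_le hp hdeg hη (hg.mem_Gstar hm) (x := ∑ u : Finset (Fin s),
      η (insert s (u.map Fin.valEmbedding)) * ∑ n ∈ Finset.Icc 1 (b ^ m - 1),
        (∏ j ∈ u, qualityFactor b m p (g j) n) * qualityFactor b m p h n) fun h' hh' => by
      have := hmin h' hh'
      rw [quality_snoc, quality_snoc] at this
      linarith
    linarith

open Classical in
/-- The truncated worst-case error for `α = 1`, in terms of the dual lattice. -/
def truncError (b : ℕ) [Fact b.Prime] (η : Finset ℕ → ℝ) (m : ℕ) (p : (ZMod b)[X]) {d : ℕ}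
    (g : Fin d → (ZMod b)[X]) : ℝ :=
  ∑ u ∈ (Finset.univ : Finset (Finset (Fin d))).erase ∅, η (u.map Fin.valEmbedding) *
    ∑ k ∈ suppBox (b ^ m) u with InDual m p g k, ∏ j, (decay b 1 (k j))⁻¹

theorem CBC.truncError_le (hp : Irreducible p) (hdeg : p.natDegree = m) (hm : m ≠ 0)
    {η : Finset ℕ → ℝ} (hη : ∀ u, 0 < η u) {s : ℕ} {g : Fin s → (ZMod b)[X]}
    (h : CBC b η m p s g) :
    truncError b η m p g ≤ kernelBound b η m s / ((b : ℝ) ^ m - 1) := by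
  classical
  have hN := one_lt_pow_card (b := b) hm
  have hsum : (b : ℝ) ^ m * truncError b η m p g =
      quality b η m p g + (kernelBound b η m s - η ∅) := by
    have h1 : ∀ F : Finset (Fin s) → ℝ, ∑ u ∈ Finset.univ.erase ∅, F u = ∑ u, F u - F ∅ := by
      intro F
      rw [← Finset.sum_erase_add (a := (∅ : Finset (Fin s))) _ _ (Finset.mem_univ _)]
      ring
    have h2 : kernelBound b η m s - η ∅ = ∑ u ∈ (Finset.univ : Finset (Finset (Fin s))).erase ∅,
        η (u.map Fin.valEmbedding) * (m * ((b : ℝ) - 1)) ^ u.card := by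
      rw [h1, kernelBound, sum_powerset_range]
      simp
    rw [h2, quality, truncError, Finset.powerset_univ, Finset.mul_sum, ← Finset.sum_add_distrib]
    refine Finset.sum_congr rfl fun u _ => ?_
    have h3 := sum_prod_qualityFactor hp hdeg (h.mem_Gstar hm) u
    rw [sum_prod_kernelVal] at h3
    unfold qualityFactor at h3
    rw [h3]
    ring
  have hq := h.quality_le hp hdeg hm hη
  rw [le_div_iff₀ (by linarith)]
  have h4 : (b : ℝ) ^ m * (truncError b η m p g * ((b : ℝ) ^ m - 1)) ≤
      (b : ℝ) ^ m * (kernelBound b η m s - η ∅) := by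
    rw [← mul_assoc, hsum]
    linarith
  have h5 := le_of_mul_le_mul_left h4 (by linarith)
  linarith [hη ∅]

end

/-! ### Growth of the product of the weights -/

theorem kernelBound_le_prod {b : ℕ} [Fact b.Prime] {η : Finset ℕ → ℝ} (hη : ∀ u, 0 < η u) (m d : ℕ) :
    kernelBound b η m d ≤ η ∅ * ∏ j ∈ Finset.range d,
      (1 + m * (((b : ℝ) - 1) * maxPreceding j fun v => η (insert j v) / η v)) := by
  have hM := kernelFactor_nonneg b m
  induction d with
  | zero => simp [kernelBound]
  | succ d ih =>
    rw [Finset.prod_range_succ, ← mul_assoc]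
    have h1 : kernelBound b η m (d + 1) ≤ kernelBound b η m d *
        (1 + m * (((b : ℝ) - 1) * maxPreceding d fun v => η (insert d v) / η v)) := by
      rw [mul_add, mul_one]
      unfold kernelBound
      rw [sum_powerset_range_succ, Finset.sum_mul]
      refine add_le_add le_rfl (Finset.sum_le_sum fun u hu => ?_)
      have hd : d ∉ u := fun h => by simpa using Finset.mem_powerset.mp hu h
      have h2 : η (insert d u) / η u ≤ maxPreceding d fun v => η (insert d v) / η v :=
        Finset.le_sup' (fun v => η (insert d v) / η v) hu
      rw [div_le_iff₀ (hη u)] at h2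
      rw [Finset.card_insert_of_notMem hd, pow_succ]
      calc η (insert d u) * ((m * ((b : ℝ) - 1)) ^ u.card * (m * ((b : ℝ) - 1)))
          ≤ ((maxPreceding d fun v => η (insert d v) / η v) * η u) *
            ((m * ((b : ℝ) - 1)) ^ u.card * (m * ((b : ℝ) - 1))) := by gcongr
        _ = _ := by ring
    refine h1.trans (mul_le_mul_of_nonneg_right ih ?_)
    have h3 : 0 ≤ maxPreceding d fun v => η (insert d v) / η v :=
      (div_pos (hη _) (hη _)).le.trans
        (Finset.le_sup' (fun v => η (insert d v) / η v) (Finset.empty_mem_powerset _))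
    have := mul_nonneg hM h3
    rw [mul_assoc] at this
    linarith

/-- For a summable sequence `a`, the product `∏ (1 + m a_j)` grows slower than any exponential in `m`,
uniformly in the number of factors: a tail with small sum contributes little to the exponent, and the
remaining factors are finitely many. -/
theorem exists_prod_one_add_le {a : ℕ → ℝ} (ha : ∀ j, 0 ≤ a j) (hs : Summable a) {τ : ℝ}
    (hτ : 0 < τ) :
    ∃ C : ℝ, 0 < C ∧ ∀ m d : ℕ, ∏ j ∈ Finset.range d, (1 + m * a j) ≤ C * Real.exp (m * τ) := by
  obtain ⟨J, hJ⟩ : ∃ J, ∑' j, a (j + J) < τ / 2 :=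
    ((tendsto_sum_nat_add a).eventually_lt_const (by positivity)).exists
  -- With `J t ≤ τ / 2`, the `J` factors of the head are at most `(1 + a j / t) exp (t m)` each.
  set t : ℝ := τ / (2 * (J + 1)) with ht
  have htpos : 0 < t := by positivity
  refine ⟨∏ j ∈ Finset.range J, (1 + a j / t), ?_, fun m d => ?_⟩
  · exact Finset.prod_pos fun j _ => by have := ha j; positivity
  have hm : (0 : ℝ) ≤ m := Nat.cast_nonneg m
  have h1 : ∏ j ∈ Finset.range d, (1 + m * a j) ≤ ∏ j ∈ Finset.range (J + d), (1 + m * a j) := by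
    refine Finset.prod_le_prod_of_subset_of_one_le (Finset.range_subset_range.mpr (by omega))
      (fun j _ => ?_) fun j _ _ => ?_
    · have := mul_nonneg hm (ha j); linarith
    · have := mul_nonneg hm (ha j); linarith
  have h2 : ∏ j ∈ Finset.range J, (1 + m * a j) ≤
      (∏ j ∈ Finset.range J, (1 + a j / t)) * Real.exp (m * (τ / 2)) := by
    calc ∏ j ∈ Finset.range J, (1 + m * a j)
        ≤ ∏ j ∈ Finset.range J, ((1 + a j / t) * Real.exp (t * m)) := by
          refine Finset.prod_le_prod (fun j _ => ?_) fun j _ => ?_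
          · have := mul_nonneg hm (ha j); linarith
          · have h3 := Real.add_one_le_exp (t * m)
            have h4 : 0 ≤ a j / t := div_nonneg (ha j) htpos.le
            have h5 : (m : ℝ) * a j = a j / t * (t * m) := by field_simp
            have h6 : 0 ≤ t * m := by positivity
            calc 1 + m * a j ≤ (1 + a j / t) * (t * m + 1) := by rw [h5]; nlinarith
              _ ≤ _ := by gcongr
      _ = (∏ j ∈ Finset.range J, (1 + a j / t)) * Real.exp (J * (t * m)) := by
          rw [Finset.prod_mul_distrib, Finset.prod_const, Finset.card_range, ← Real.exp_nat_mul]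
      _ ≤ _ := by
          refine mul_le_mul_of_nonneg_left (Real.exp_le_exp.mpr ?_)
            (Finset.prod_nonneg fun j _ => by have := ha j; positivity)
          have h7 : (J : ℝ) * t ≤ τ / 2 := by
            rw [ht, mul_div_assoc', div_le_div_iff₀ (by positivity) (by positivity)]
            nlinarith
          calc (J : ℝ) * (t * m) = m * (J * t) := by ring
            _ ≤ _ := by gcongr
  have h8 : ∏ j ∈ Finset.range d, (1 + m * a (J + j)) ≤ Real.exp (m * (τ / 2)) := by
    calc ∏ j ∈ Finset.range d, (1 + m * a (J + j))
        ≤ ∏ j ∈ Finset.range d, Real.exp (m * a (J + j)) := by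
          refine Finset.prod_le_prod (fun j _ => ?_) fun j _ => ?_
          · have := mul_nonneg hm (ha (J + j)); linarith
          · linarith [Real.add_one_le_exp (m * a (J + j))]
      _ = Real.exp (m * ∑ j ∈ Finset.range d, a (j + J)) := by
          rw [← Real.exp_sum, Finset.mul_sum]
          simp_rw [add_comm J]
      _ ≤ _ := by
          gcongr
          exact (((summable_nat_add_iff J).mpr hs).sum_le_tsum _ fun j _ => ha _).trans hJ.le
  refine h1.trans ?_
  rw [Finset.prod_range_add]
  calc _ ≤ ((∏ j ∈ Finset.range J, (1 + a j / t)) * Real.exp (m * (τ / 2))) *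
        Real.exp (m * (τ / 2)) := by
        refine mul_le_mul h2 h8 (Finset.prod_nonneg fun j _ => ?_) ?_
        · have := mul_nonneg hm (ha (J + j)); linarith
        · exact mul_nonneg (Finset.prod_nonneg fun j _ => by have := ha j; positivity)
            (Real.exp_pos _).le
    _ = _ := by
        rw [mul_assoc, ← Real.exp_add]
        congr 2
        ring

/-- The bound `T ≤ C N ^ (δ - 1)` for the truncated error of every output of the algorithm. -/
theorem exists_truncError_le {b : ℕ} [Fact b.Prime] {η : Finset ℕ → ℝ} (hη : ∀ u, 0 < η u)
    (hs : Summable fun j : ℕ => maxPreceding j fun v => η (insert j v) / η v) {δ : ℝ} (hδ : 0 < δ) :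
    ∃ C : ℝ, 0 < C ∧ ∀ m d : ℕ, m ≠ 0 → ∀ p : (ZMod b)[X], Irreducible p → p.natDegree = m →
      ∀ g : Fin d → (ZMod b)[X], CBC b η m p d g →
        truncError b η m p g ≤ C * ((b : ℝ) ^ m) ^ δ / (b : ℝ) ^ m := by
  have hb : (1 : ℝ) < b := by exact_mod_cast (Fact.out : b.Prime).one_lt
  obtain ⟨C, hC, h⟩ := exists_prod_one_add_le
    (a := fun j => ((b : ℝ) - 1) * maxPreceding j fun v => η (insert j v) / η v)
    (fun j => mul_nonneg (by linarith) ((div_pos (hη _) (hη _)).le.trans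
      (Finset.le_sup' (fun v => η (insert j v) / η v) (Finset.empty_mem_powerset _))))
    (hs.mul_left _) (τ := δ * Real.log b) (mul_pos hδ (Real.log_pos hb))
  refine ⟨2 * (η ∅ * C), by have := hη ∅; positivity, fun m d hm p hp hdeg g hg => ?_⟩
  have hN2 : (2 : ℝ) ≤ (b : ℝ) ^ m := by
    have h2 : (2 : ℝ) ≤ b := by exact_mod_cast (Fact.out : b.Prime).two_le
    calc (2 : ℝ) ≤ (b : ℝ) ^ 1 := by simpa using h2
      _ ≤ (b : ℝ) ^ m := pow_le_pow_right₀ hb.le (Nat.one_le_iff_ne_zero.mpr hm)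
  have hexp : Real.exp (m * (δ * Real.log b)) = ((b : ℝ) ^ m) ^ δ := by
    rw [Real.rpow_def_of_pos (by positivity), Real.log_pow]
    congr 1
    ring
  have hK : kernelBound b η m d ≤ η ∅ * C * ((b : ℝ) ^ m) ^ δ := by
    rw [mul_assoc, ← hexp]
    exact (kernelBound_le_prod hη m d).trans (mul_le_mul_of_nonneg_left (h m d) (hη ∅).le)
  have h0 : 0 ≤ η ∅ * C * ((b : ℝ) ^ m) ^ δ := by have := hη ∅; positivity
  calc truncError b η m p g ≤ kernelBound b η m d / ((b : ℝ) ^ m - 1) :=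
        hg.truncError_le hp hdeg hm hη
    _ ≤ η ∅ * C * ((b : ℝ) ^ m) ^ δ / ((b : ℝ) ^ m / 2) :=
        div_le_div₀ h0 hK (by linarith) (by linarith)
    _ = _ := by field_simp

/-! ### Sums over the dual lattice -/

theorem sum_rpow_le_rpow_sum {ι : Type*} (s : Finset ι) {a : ι → ℝ} (ha : ∀ i ∈ s, 0 ≤ a i) {α : ℝ}
    (hα : 1 ≤ α) : ∑ i ∈ s, a i ^ α ≤ (∑ i ∈ s, a i) ^ α := by
  classical
  induction s using Finset.induction_on with
  | empty => simp [Real.zero_rpow (by linarith : α ≠ 0)]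
  | insert i s hi ih =>
    rw [Finset.sum_insert hi, Finset.sum_insert hi]
    have h1 : ∀ j ∈ s, 0 ≤ a j := fun j hj => ha j (Finset.mem_insert_of_mem hj)
    exact (add_le_add le_rfl (ih h1)).trans (Real.add_rpow_le_rpow_add
      (ha i (Finset.mem_insert_self i s)) (Finset.sum_nonneg h1) hα)

theorem tsum_pi_prod_le {d : ℕ} (F : Fin d → ℕ → ℝ≥0∞) :
    ∑' k : Fin d → ℕ, ∏ i, F i (k i) ≤ ∏ i, ∑' l, F i l := by
  classical
  rw [ENNReal.tsum_eq_iSup_sum]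
  refine iSup_le fun s => ?_
  calc ∑ k ∈ s, ∏ i, F i (k i)
      ≤ ∑ k ∈ Fintype.piFinset fun i => s.image fun k => k i, ∏ i, F i (k i) :=
        Finset.sum_le_sum_of_subset fun k hk =>
          Fintype.mem_piFinset.mpr fun i => Finset.mem_image_of_mem _ hk
    _ = ∏ i, ∑ l ∈ s.image (fun k => k i), F i l := (Finset.prod_univ_sum _ _).symm
    _ ≤ _ := by
        gcongr
        exact ENNReal.sum_le_tsum _

theorem decay_eq_rpow (b : ℕ) (α : ℝ) (k : ℕ) : decay b α k = decay b 1 k ^ α := by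
  unfold decay
  split_ifs
  · rw [Real.one_rpow]
  · rw [← Real.rpow_mul (Nat.cast_nonneg b)]
    congr 1
    ring

/-- The support of an integer vector, as a set of coordinates in `Fin d`. -/
def finSupp {d : ℕ} (k : Fin d → ℕ) : Finset (Fin d) := Finset.univ.filter fun j => k j ≠ 0

theorem mem_finSupp {d : ℕ} {k : Fin d → ℕ} {j : Fin d} : j ∈ finSupp k ↔ k j ≠ 0 := by
  simp [finSupp]

theorem weightedDecay_inv {b d : ℕ} {α : ℝ} {γ : Finset ℕ → ℝ} {k : Fin d → ℕ} :
    (weightedDecay b α γ k)⁻¹ =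
      γ ((finSupp k).map Fin.valEmbedding) * ∏ i, (decay b α (k i))⁻¹ := by
  rw [weightedDecay, mul_inv, inv_inv, Finset.prod_inv_distrib]
  rfl

section
variable {b : ℕ} [Fact b.Prime]

theorem summable_decay {α : ℝ} (hα : 1 < α) : Summable fun k : ℕ => (decay b α (k + 1))⁻¹ := by
  have hb := (Fact.out : b.Prime)
  have hb0 : (0 : ℝ) < b := by exact_mod_cast hb.pos
  have hs : Summable fun k : ℕ => (b : ℝ) ^ α * (((k + 1 : ℕ) : ℝ) ^ α)⁻¹ :=
    ((summable_nat_add_iff 1).mpr (Real.summable_nat_rpow_inv.mpr hα)).mul_left _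
  refine hs.of_nonneg_of_le (fun k => inv_nonneg.mpr (decay_pos _ _).le) fun k => ?_
  have h1 : ((k + 1 : ℕ) : ℝ) ≤ (b : ℝ) ^ (Nat.log b (k + 1) : ℝ) * b := by
    rw [Real.rpow_natCast, ← pow_succ]
    exact_mod_cast (Nat.lt_pow_succ_log_self hb.one_lt (k + 1)).le
  have h2 : ((k + 1 : ℕ) : ℝ) ^ α ≤ decay b α (k + 1) * (b : ℝ) ^ α := by
    rw [decay, if_neg (Nat.succ_ne_zero k), mul_comm α, Real.rpow_mul hb0.le,
      ← Real.mul_rpow (by positivity) hb0.le]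
    exact Real.rpow_le_rpow (by positivity) h1 (by linarith)
  have h3 : (0 : ℝ) < ((k + 1 : ℕ) : ℝ) ^ α := by positivity
  rw [← div_eq_mul_inv, inv_eq_one_div, div_le_div_iff₀ (decay_pos _ _) h3, one_mul,
    mul_comm _ (decay _ _ _)]
  exact h2

theorem mu_nonneg (b : ℕ) [Fact b.Prime] (α : ℝ) : 0 ≤ mu b α :=
  tsum_nonneg fun _ => inv_nonneg.mpr (decay_pos _ _).le

theorem decay_div_pow (α : ℝ) {m k : ℕ} (hk : b ^ m ≤ k) :
    decay b α k = ((b : ℝ) ^ m) ^ α * decay b α (k / b ^ m) := by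
  have hb := (Fact.out : b.Prime)
  have hN : 0 < b ^ m := Nat.pow_pos hb.pos
  have h0 : k / b ^ m ≠ 0 := (Nat.div_pos hk hN).ne'
  have hlog : m ≤ Nat.log b k := Nat.le_log_of_pow_le hb.one_lt hk
  rw [decay, decay, if_neg h0, if_neg (by omega), Nat.log_div_base_pow, Nat.cast_sub hlog,
    ← Real.rpow_natCast, ← Real.rpow_mul (Nat.cast_nonneg b),
    ← Real.rpow_add (by exact_mod_cast hb.pos)]
  congr 1
  ring

variable {m : ℕ} {p : (ZMod b)[X]} {d : ℕ}

theorem tsum_finSupp_le {α : ℝ} (hα : 1 < α) (u : Finset (Fin d)) :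
    ∑' k : Fin d → ℕ, (if finSupp k = u then ENNReal.ofReal (∏ i, (decay b α (k i))⁻¹) else 0) ≤
      ENNReal.ofReal (mu b α ^ u.card) := by
  classical
  set F : Fin d → ℕ → ℝ≥0∞ := fun i l =>
    if i ∈ u then (if l = 0 then 0 else ENNReal.ofReal (decay b α l)⁻¹) else if l = 0 then 1 else 0
    with hF
  have h1 : ∀ k : Fin d → ℕ, (if finSupp k = u then
      ENNReal.ofReal (∏ i, (decay b α (k i))⁻¹) else 0) ≤ ∏ i, F i (k i) := by
    intro k
    split_ifs with h
    · rw [ENNReal.ofReal_prod_of_nonneg fun i _ => inv_nonneg.mpr (decay_pos _ _).le]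
      refine Finset.prod_le_prod' fun i _ => ?_
      have hi : i ∈ u ↔ k i ≠ 0 := h ▸ mem_finSupp
      by_cases hk : k i = 0
      · simp [hF, hi, hk, decay_zero]
      · simp [hF, hi, hk]
    · exact zero_le
  have h2 : ∀ i, ∑' l, F i l = if i ∈ u then ENNReal.ofReal (mu b α) else 1 := by
    intro i
    by_cases hi : i ∈ u
    · simp only [hF, hi, if_true]
      rw [tsum_eq_zero_add' ENNReal.summable, mu, ENNReal.ofReal_tsum_of_nonneg
        (fun _ => inv_nonneg.mpr (decay_pos _ _).le) (summable_decay hα)]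
      simp
    · simp only [hF, hi, if_false]
      rw [tsum_ite_eq]
  calc _ ≤ ∑' k : Fin d → ℕ, ∏ i, F i (k i) := ENNReal.tsum_le_tsum h1
    _ ≤ ∏ i, ∑' l, F i l := tsum_pi_prod_le F
    _ = _ := by
      simp_rw [h2]
      rw [Finset.prod_ite_mem, Finset.univ_inter, Finset.prod_const,
        ENNReal.ofReal_pow (mu_nonneg b α)]

open Classical in
/-- The part of the dual lattice where the entry `j` is at least `b ^ m`. Once the other entries and
the digits of `k j` from the `m`-th on are fixed, the first `m` digits of `k j` are determined, so
replacing `k j` by `k j / b ^ m` is injective; it multiplies `1 / r_α` by `N ^ α`. -/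
theorem tsum_dual_large_le (hp : Irreducible p) (hdeg : p.natDegree = m) {g : Fin d → (ZMod b)[X]}
    {j : Fin d} (hj : g j ∈ Gstar b m) {α : ℝ} (hα : 1 < α) (u : Finset (Fin d)) :
    ∑' k : Fin d → ℕ, (if finSupp k = u ∧ b ^ m ≤ k j ∧ InDual m p g k then
      ENNReal.ofReal (∏ i, (decay b α (k i))⁻¹) else 0) ≤
      ENNReal.ofReal ((((b : ℝ) ^ m) ^ α)⁻¹ * mu b α ^ u.card) := by
  have hN : 0 < b ^ m := Nat.pow_pos (Fact.out : b.Prime).pos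
  set S : Set (Fin d → ℕ) := {k | finSupp k = u ∧ b ^ m ≤ k j ∧ InDual m p g k} with hS
  set F : (Fin d → ℕ) → ℝ≥0∞ := fun k =>
    if finSupp k = u then ENNReal.ofReal (∏ i, (decay b α (k i))⁻¹) else 0 with hF
  -- The quotient and the remainder of `k j` modulo `b ^ m` are both recovered.
  have hinj : Function.Injective fun k : S => Function.update k.1 j (k.1 j / b ^ m) := by
    rintro ⟨k, hk⟩ ⟨l, hl⟩ h
    simp only at h
    have h1 : ∀ i, i ≠ j → k i = l i := fun i hi => by
      simpa [Function.update_of_ne hi] using congrFun h i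
    have h2 : k j / b ^ m = l j / b ^ m := by simpa using congrFun h j
    have h3 := hk.2.2.mod_eq hp hdeg hl.2.2 hj h1
    refine Subtype.ext (funext fun i => ?_)
    by_cases hi : i = j
    · subst hi
      change k i = l i
      rw [← Nat.div_add_mod (k i) (b ^ m), h2, h3, Nat.div_add_mod]
    · exact h1 i hi
  have hval : ∀ k : S, ENNReal.ofReal (∏ i, (decay b α (k.1 i))⁻¹) =
      ENNReal.ofReal (((b : ℝ) ^ m) ^ α)⁻¹ *
        F (Function.update k.1 j (k.1 j / b ^ m)) := by
    rintro ⟨k, hk⟩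
    have h1 : finSupp (Function.update k j (k j / b ^ m)) = u := by
      rw [← hk.1]
      ext i
      rw [mem_finSupp, mem_finSupp]
      by_cases hi : i = j
      · subst hi
        have h2 := (Nat.div_pos hk.2.1 hN).ne'
        have h3 := hk.2.1
        rw [Function.update_self]
        exact ⟨fun _ => by omega, fun _ => h2⟩
      · rw [Function.update_of_ne hi]
    simp only [hF, h1, if_true]
    rw [← ENNReal.ofReal_mul (by positivity)]
    congr 1
    rw [← Finset.mul_prod_erase _ _ (Finset.mem_univ j),
      ← Finset.mul_prod_erase Finset.univ
        (fun i => (decay b α (Function.update k j (k j / b ^ m) i))⁻¹) (Finset.mem_univ j),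
      decay_div_pow α hk.2.1, mul_inv, mul_assoc, Function.update_self]
    congr 2
    refine Finset.prod_congr rfl fun i hi => ?_
    rw [Function.update_of_ne (Finset.ne_of_mem_erase hi)]
  have hsub := tsum_subtype S fun k => ENNReal.ofReal (∏ i, (decay b α (k i))⁻¹)
  calc _ = ∑' k : S, ENNReal.ofReal (∏ i, (decay b α (k.1 i))⁻¹) := by
        rw [hsub]
        refine tsum_congr fun k => ?_
        rw [Set.indicator_apply]
        rfl
    _ = ENNReal.ofReal (((b : ℝ) ^ m) ^ α)⁻¹ *
        ∑' k : S, F (Function.update k.1 j (k.1 j / b ^ m)) := by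
        rw [tsum_congr hval, ENNReal.tsum_mul_left]
    _ ≤ ENNReal.ofReal (((b : ℝ) ^ m) ^ α)⁻¹ * ∑' k, F k :=
        mul_le_mul_right (ENNReal.tsum_comp_le_tsum_of_injective hinj F) _
    _ ≤ ENNReal.ofReal (((b : ℝ) ^ m) ^ α)⁻¹ * ENNReal.ofReal (mu b α ^ u.card) :=
        mul_le_mul_right (tsum_finSupp_le hα u) _
    _ = _ := (ENNReal.ofReal_mul (by positivity)).symm

theorem mem_suppBox {N : ℕ} {u : Finset (Fin d)} {k : Fin d → ℕ} (hN : 0 < N) :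
    k ∈ suppBox N u ↔ finSupp k = u ∧ ∀ j, k j < N := by
  unfold suppBox
  rw [Fintype.mem_piFinset]
  constructor
  · intro h
    have h1 : ∀ j, (j ∈ u ↔ k j ≠ 0) ∧ k j < N := by
      intro j
      have := h j
      by_cases hj : j ∈ u
      · simp only [hj, if_true, Finset.mem_Ico] at this
        exact ⟨⟨fun _ => by omega, fun _ => hj⟩, this.2⟩
      · simp only [hj, if_false, Finset.mem_singleton] at this
        simp [hj, this, hN]
    refine ⟨Finset.ext fun j => ?_, fun j => (h1 j).2⟩
    rw [mem_finSupp, (h1 j).1]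
  · rintro ⟨rfl, h⟩ j
    have := h j
    by_cases hj : k j = 0
    · simp [mem_finSupp, hj]
    · simp [mem_finSupp, hj, this]; omega

open Classical in
/-- The sum over the dual lattice that bounds the worst-case error. The part with all entries less than
`b ^ m` is at most the `α`-th power of the truncated error for `α = 1`, by Jensen's inequality. -/
theorem tsum_dual_le (hp : Irreducible p) (hdeg : p.natDegree = m) {γ : Finset ℕ → ℝ}
    (hγ : ∀ u, 0 < γ u) {g : Fin d → (ZMod b)[X]} (hg : ∀ j, g j ∈ Gstar b m) {α : ℝ} (hα : 1 < α) :
    ∑' k : Fin d → ℕ, (if k ≠ 0 ∧ InDual m p g k then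
      ENNReal.ofReal (weightedDecay b α (fun u => γ u ^ α) k)⁻¹ else 0) ≤
      ENNReal.ofReal (truncError b γ m p g ^ α + (((b : ℝ) ^ m) ^ α)⁻¹ *
        ∑ u ∈ (Finset.range d).powerset.erase ∅, γ u ^ α * (2 * mu b α) ^ u.card) := by
  have hN : 0 < b ^ m := Nat.pow_pos (Fact.out : b.Prime).pos
  have hmu := mu_nonneg b α
  set U : Finset (Finset (Fin d)) := Finset.univ.erase ∅ with hU
  set w : (Fin d → ℕ) → ℝ≥0∞ := fun k =>
    ENNReal.ofReal (weightedDecay b α (fun u => γ u ^ α) k)⁻¹ with hw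
  set H : Finset (Fin d) → (Fin d → ℕ) → ℝ≥0∞ := fun u k =>
    if k ∈ {k ∈ suppBox (b ^ m) u | InDual m p g k} then w k else 0 with hH
  set L : Finset (Fin d) → Fin d → (Fin d → ℕ) → ℝ≥0∞ := fun u j k =>
    ENNReal.ofReal (γ (u.map Fin.valEmbedding) ^ α) *
      if finSupp k = u ∧ b ^ m ≤ k j ∧ InDual m p g k then
        ENNReal.ofReal (∏ i, (decay b α (k i))⁻¹) else 0 with hL
  have hsplit : ∀ k : Fin d → ℕ, (if k ≠ 0 ∧ InDual m p g k then w k else 0) ≤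
      ∑ u ∈ U, H u k + ∑ u ∈ U, ∑ j ∈ u, L u j k := by
    intro k
    split_ifs with hk
    · have hu : finSupp k ∈ U := by
        rw [hU, Finset.mem_erase]
        refine ⟨fun h => hk.1 (funext fun j => ?_), Finset.mem_univ _⟩
        by_contra hj
        have := mem_finSupp.mpr hj
        rw [h] at this
        simp at this
      by_cases hlt : ∀ j, k j < b ^ m
      · refine le_trans ?_ le_self_add
        refine le_trans ?_ (Finset.single_le_sum_of_canonicallyOrdered hu)
        simp only [hH]
        rw [if_pos (Finset.mem_filter.mpr ⟨(mem_suppBox hN).mpr ⟨rfl, hlt⟩, hk.2⟩)]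
      · push Not at hlt
        obtain ⟨j, hj⟩ := hlt
        refine le_trans ?_ le_add_self
        refine le_trans ?_ (Finset.single_le_sum_of_canonicallyOrdered hu)
        refine le_trans ?_ (Finset.single_le_sum_of_canonicallyOrdered
          (mem_finSupp.mpr (by omega : k j ≠ 0)))
        simp only [hL, hw]
        rw [if_pos ⟨trivial, hj, hk.2⟩, weightedDecay_inv,
          ENNReal.ofReal_mul (Real.rpow_nonneg (hγ _).le _)]
    · exact zero_le
  have hhead : ∑' k, ∑ u ∈ U, H u k ≤ ENNReal.ofReal (truncError b γ m p g ^ α) := by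
    rw [Summable.tsum_finsetSum fun _ _ => ENNReal.summable]
    have h1 : ∀ u ∈ U, ∑' k, H u k ≤ ENNReal.ofReal ((γ (u.map Fin.valEmbedding) *
        ∑ k ∈ suppBox (b ^ m) u with InDual m p g k, ∏ i, (decay b 1 (k i))⁻¹) ^ α) := by
      intro u _
      rw [tsum_eq_sum (s := {k ∈ suppBox (b ^ m) u | InDual m p g k})
        fun k hk => by simp only [hH]; rw [if_neg hk]]
      have h2 : ∀ k ∈ {k ∈ suppBox (b ^ m) u | InDual m p g k}, H u k = ENNReal.ofReal
          ((γ (u.map Fin.valEmbedding) * ∏ i, (decay b 1 (k i))⁻¹) ^ α) := by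
        intro k hk
        simp only [hH, hw]
        rw [if_pos hk, weightedDecay_inv, ((mem_suppBox hN).mp (Finset.mem_filter.mp hk).1).1,
          Real.mul_rpow (hγ _).le (Finset.prod_nonneg fun i _ => inv_nonneg.mpr (decay_pos _ _).le),
          ← Real.finsetProd_rpow _ _ fun i _ => inv_nonneg.mpr (decay_pos _ _).le]
        simp_rw [Real.inv_rpow (decay_pos _ _).le, ← decay_eq_rpow]
      rw [Finset.sum_congr rfl h2, ← ENNReal.ofReal_sum_of_nonneg, Finset.mul_sum]
      · refine ENNReal.ofReal_le_ofReal (sum_rpow_le_rpow_sum _ (fun k _ => ?_) hα.le)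
        exact mul_nonneg (hγ _).le (Finset.prod_nonneg fun i _ => inv_nonneg.mpr (decay_pos _ _).le)
      · intro k _
        exact Real.rpow_nonneg (mul_nonneg (hγ _).le
          (Finset.prod_nonneg fun i _ => inv_nonneg.mpr (decay_pos _ _).le)) _
    have h3 : ∀ u ∈ U, 0 ≤ γ (u.map Fin.valEmbedding) *
        ∑ k ∈ suppBox (b ^ m) u with InDual m p g k, ∏ i, (decay b 1 (k i))⁻¹ := fun u _ =>
      mul_nonneg (hγ _).le (Finset.sum_nonneg fun k _ =>
        Finset.prod_nonneg fun i _ => inv_nonneg.mpr (decay_pos _ _).le)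
    refine (Finset.sum_le_sum h1).trans ?_
    rw [← ENNReal.ofReal_sum_of_nonneg fun u hu => Real.rpow_nonneg (h3 u hu) _]
    exact ENNReal.ofReal_le_ofReal (sum_rpow_le_rpow_sum _ h3 hα.le)
  have htail : ∑' k, ∑ u ∈ U, ∑ j ∈ u, L u j k ≤ ENNReal.ofReal ((((b : ℝ) ^ m) ^ α)⁻¹ *
      ∑ u ∈ (Finset.range d).powerset.erase ∅, γ u ^ α * (2 * mu b α) ^ u.card) := by
    rw [Summable.tsum_finsetSum fun _ _ => ENNReal.summable]
    have h1 : ∀ u ∈ U, ∑' k, ∑ j ∈ u, L u j k ≤ ENNReal.ofReal ((((b : ℝ) ^ m) ^ α)⁻¹ *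
        (γ (u.map Fin.valEmbedding) ^ α * (2 * mu b α) ^ u.card)) := by
      intro u _
      have hγu : 0 ≤ γ (u.map Fin.valEmbedding) ^ α := Real.rpow_nonneg (hγ _).le _
      rw [Summable.tsum_finsetSum fun _ _ => ENNReal.summable]
      calc ∑ j ∈ u, ∑' k, L u j k
          ≤ ∑ j ∈ u, ENNReal.ofReal (γ (u.map Fin.valEmbedding) ^ α *
            ((((b : ℝ) ^ m) ^ α)⁻¹ * mu b α ^ u.card)) := by
            refine Finset.sum_le_sum fun j _ => ?_
            simp only [hL]
            rw [ENNReal.tsum_mul_left, ENNReal.ofReal_mul hγu]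
            exact mul_le_mul_right (tsum_dual_large_le hp hdeg (hg j) hα u) _
        _ = ENNReal.ofReal (u.card * (γ (u.map Fin.valEmbedding) ^ α *
            ((((b : ℝ) ^ m) ^ α)⁻¹ * mu b α ^ u.card))) := by
            rw [Finset.sum_const, nsmul_eq_mul, ENNReal.ofReal_mul (Nat.cast_nonneg _),
              ENNReal.ofReal_natCast]
        _ ≤ _ := by
            refine ENNReal.ofReal_le_ofReal ?_
            -- The factor `|u|`, from the choice of the large entry, is absorbed into `(2 μ) ^ |u|`.
            have h2 : (u.card : ℝ) ≤ 2 ^ u.card := by exact_mod_cast Nat.lt_two_pow_self.le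
            calc _ ≤ 2 ^ u.card * (γ (u.map Fin.valEmbedding) ^ α *
                  ((((b : ℝ) ^ m) ^ α)⁻¹ * mu b α ^ u.card)) := by gcongr
              _ = _ := by rw [mul_pow]; ring
    refine (Finset.sum_le_sum h1).trans ?_
    rw [← ENNReal.ofReal_sum_of_nonneg fun u _ => by have := hγ (u.map Fin.valEmbedding); positivity,
      ← Finset.mul_sum]
    refine ENNReal.ofReal_le_ofReal (le_of_eq ?_)
    congr 1
    have h4 := sum_powerset_range d fun u => γ u ^ α * (2 * mu b α) ^ u.card
    rw [← Finset.sum_erase_add _ _ (Finset.empty_mem_powerset _),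
      ← Finset.sum_erase_add (a := (∅ : Finset (Fin d))) _ _ (Finset.mem_univ _), Finset.map_empty] at h4
    simpa only [Finset.card_map] using (add_right_cancel h4).symm
  calc _ ≤ ∑' k, (∑ u ∈ U, H u k + ∑ u ∈ U, ∑ j ∈ u, L u j k) := ENNReal.tsum_le_tsum hsplit
    _ = ∑' k, ∑ u ∈ U, H u k + ∑' k, ∑ u ∈ U, ∑ j ∈ u, L u j k := ENNReal.tsum_add
    _ ≤ _ := add_le_add hhead htail
    _ = _ := by
      rw [← ENNReal.ofReal_add]
      · refine Real.rpow_nonneg (Finset.sum_nonneg fun u _ => ?_) _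
        exact mul_nonneg (hγ _).le (Finset.sum_nonneg fun k _ =>
          Finset.prod_nonneg fun i _ => inv_nonneg.mpr (decay_pos _ _).le)
      · refine mul_nonneg (by positivity) (Finset.sum_nonneg fun u _ => ?_)
        have := hγ u
        positivity

end

/-! ### The worst-case error -/

theorem cubeIntegral_eq_walshCoeff (b : ℕ) {d : ℕ} (f : (Fin d → ℝ) → ℂ) :
    cubeIntegral f = walshCoeff b f 0 := by
  simp [walshCoeff, walVec, wal, natLen]

section
variable {b : ℕ} [Fact b.Prime] {m : ℕ} {p : (ZMod b)[X]} {d : ℕ}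

theorem latticePoint_mem {g : Fin d → (ZMod b)[X]} {n : ℕ} (hn : n < b ^ m) (j : Fin d) :
    latticePoint b m p g n j ∈ Set.Ico (0 : ℝ) 1 := by
  unfold latticePoint
  rw [latticeCoord_eq hn]
  exact ⟨digitReal_nonneg _ _ _, digitReal_lt_one (Fact.out : b.Prime).pos m (vecDigits_lt _)⟩

theorem walVec_latticePoint {g : Fin d → (ZMod b)[X]} {n : ℕ} (hn : n < b ^ m) (k : Fin d → ℕ) :
    walVec b k (latticePoint b m p g n) =
      ∏ j, walChar (k j) (genMap m p (g j) (digitVec b m n)) := by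
  unfold walVec latticePoint
  refine Finset.prod_congr rfl fun j _ => ?_
  rw [latticeCoord_eq hn, wal_digitReal]

open Classical in
/-- The error of the rule is the sum of the Walsh coefficients over the dual lattice without `0`: the
mean of a Walsh function over the points is `1` on the dual lattice and `0` off it. -/
theorem qmc_sub_cubeIntegral_le {α : ℝ} {γ : Finset ℕ → ℝ} (hγ : ∀ u, 0 < γ u)
    (g : Fin d → (ZMod b)[X]) {f : (Fin d → ℝ) → ℂ} (hf : f ∈ walshSpace b α γ d)
    (hf1 : walshNorm b α γ f ≤ 1) :
    ENNReal.ofReal ‖qmc (b ^ m) (latticePoint b m p g) f - cubeIntegral f‖ ≤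
      ∑' k : Fin d → ℕ, if k ≠ 0 ∧ InDual m p g k then
        ENNReal.ofReal (weightedDecay b α γ k)⁻¹ else 0 := by
  have hb0 : ((b ^ m : ℕ) : ℂ) ≠ 0 := by
    exact_mod_cast (Nat.pow_pos (Fact.out : b.Prime).pos).ne'
  have h1 : HasSum (fun k => ∑ n ∈ Finset.range (b ^ m),
      walshCoeff b f k * walVec b k (latticePoint b m p g n))
      (∑ n ∈ Finset.range (b ^ m), f (latticePoint b m p g n)) :=
    hasSum_sum fun n hn => hf.2.1 _ (latticePoint_mem (Finset.mem_range.mp hn))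
  have h2 := (h1.mul_left (1 / ((b ^ m : ℕ) : ℂ))).sub
    (hasSum_ite_eq (0 : Fin d → ℕ) (walshCoeff b f 0))
  have h3 : ∀ k : Fin d → ℕ, 1 / ((b ^ m : ℕ) : ℂ) * ∑ n ∈ Finset.range (b ^ m),
      walshCoeff b f k * walVec b k (latticePoint b m p g n) -
      (if k = 0 then walshCoeff b f 0 else 0) =
      if k ≠ 0 ∧ InDual m p g k then walshCoeff b f k else 0 := by
    intro k
    have h4 : ∑ n ∈ Finset.range (b ^ m),
        walshCoeff b f k * walVec b k (latticePoint b m p g n) =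
        walshCoeff b f k * if InDual m p g k then ((b ^ m : ℕ) : ℂ) else 0 := by
      rw [← Finset.mul_sum]
      congr 1
      push_cast
      rw [← sum_prod_walChar, ← sum_digitVec]
      exact Finset.sum_congr rfl fun n hn => walVec_latticePoint (Finset.mem_range.mp hn) k
    rw [h4]
    by_cases hk : k = 0
    · subst hk
      have h5 : InDual m p g 0 := fun c => by simp [digitVec_zero]
      rw [if_pos h5, if_pos rfl, if_neg (by simp)]
      field_simp
      ring
    · rw [if_neg hk, sub_zero]
      by_cases hd : InDual m p g k
      · rw [if_pos hd, if_pos ⟨hk, hd⟩]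
        field_simp
      · rw [if_neg hd, if_neg fun h => hd h.2, mul_zero, mul_zero]
  simp_rw [h3] at h2
  have h6 : qmc (b ^ m) (latticePoint b m p g) f - cubeIntegral f =
      ∑' k : Fin d → ℕ, if k ≠ 0 ∧ InDual m p g k then walshCoeff b f k else 0 := by
    rw [h2.tsum_eq, cubeIntegral_eq_walshCoeff b]
    rfl
  rw [h6, ofReal_norm]
  refine enorm_tsum_le_tsum_enorm.trans (ENNReal.tsum_le_tsum fun k => ?_)
  split_ifs
  · rw [← ofReal_norm]
    refine ENNReal.ofReal_le_ofReal ?_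
    have hpos : 0 < weightedDecay b α γ k :=
      mul_pos (inv_pos.mpr (hγ _)) (Finset.prod_pos fun j _ => decay_pos _ _)
    have h7 := (le_iSup (fun k : Fin d → ℕ =>
      ENNReal.ofReal (‖walshCoeff b f k‖ * weightedDecay b α γ k)) k).trans hf1
    rw [ENNReal.ofReal_le_one] at h7
    rwa [← one_div, le_div_iff₀ hpos]
  · simp

theorem latticeError_le (hp : Irreducible p) (hdeg : p.natDegree = m) {γ : Finset ℕ → ℝ}
    (hγ : ∀ u, 0 < γ u) {g : Fin d → (ZMod b)[X]} (hg : ∀ j, g j ∈ Gstar b m) {α : ℝ} (hα : 1 < α) :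
    latticeError b α (fun u => γ u ^ α) m p g ≤
      ENNReal.ofReal (truncError b γ m p g ^ α + (((b : ℝ) ^ m) ^ α)⁻¹ *
        ∑ u ∈ (Finset.range d).powerset.erase ∅, γ u ^ α * (2 * mu b α) ^ u.card) :=
  iSup₂_le fun _ hf => (qmc_sub_cubeIntegral_le (b := b) (fun u => Real.rpow_pos_of_pos (hγ u) α) g hf.1
    hf.2).trans (tsum_dual_le hp hdeg hγ hg hα)

theorem truncError_nonneg {γ : Finset ℕ → ℝ} (hγ : ∀ u, 0 < γ u) (g : Fin d → (ZMod b)[X]) :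
    0 ≤ truncError b γ m p g :=
  Finset.sum_nonneg fun _ _ => mul_nonneg (hγ _).le (Finset.sum_nonneg fun _ _ =>
    Finset.prod_nonneg fun _ _ => inv_nonneg.mpr (decay_pos (b := b) _ _).le)

end

/-- One constant for all `α > 1` at once. -/
theorem exists_errorBound {b : ℕ} [Fact b.Prime] {γ : Finset ℕ → ℝ} (hγ : ∀ u, 0 < γ u)
    (hs : Summable fun j : ℕ => maxPreceding j fun v => γ (insert j v) / γ v) {δ : ℝ} (hδ : 0 < δ) :
    ∃ C : ℝ, 0 < C ∧ ∀ m d : ℕ, m ≠ 0 → ∀ p : (ZMod b)[X], Irreducible p → p.natDegree = m →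
      ∀ g : Fin d → (ZMod b)[X], CBC b γ m p d g → ∀ α : ℝ, 1 < α →
        latticeError b α (fun u => γ u ^ α) m p g ≤
          ENNReal.ofReal (errorBound b α δ C (fun u => γ u ^ α) m d) := by
  obtain ⟨C, hC, h⟩ := exists_truncError_le (b := b) hγ hs hδ
  refine ⟨C, hC, fun m d hm p hp hdeg g hg α hα => ?_⟩
  refine (latticeError_le hp hdeg hγ (hg.mem_Gstar hm) hα).trans (ENNReal.ofReal_le_ofReal ?_)
  have hN : (0 : ℝ) < (b : ℝ) ^ m := by
    have := (Fact.out : b.Prime).pos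
    positivity
  have h1 := Real.rpow_le_rpow (truncError_nonneg (b := b) (p := p) hγ g) (h m d hm p hp hdeg g hg)
    (by linarith : 0 ≤ α)
  rw [Real.div_rpow (by positivity) hN.le, Real.mul_rpow hC.le (by positivity),
    ← Real.rpow_mul hN.le, mul_comm δ α] at h1
  unfold errorBound
  rw [mul_add, one_div, add_comm]
  refine add_le_add le_rfl (h1.trans (le_of_eq ?_))
  rw [div_eq_mul_inv, mul_comm]

end PolyLattice

end

theorem corollary1 (b : ℕ) [Fact b.Prime] :
    ∃ C₁ C₂ : (Finset ℕ → ℝ) → ℝ → ℝ,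
      (∀ γ : Finset ℕ → ℝ, (∀ u, 0 < γ u) →
        Summable (fun j : ℕ => maxPreceding j fun v => γ (insert j v) / γ v) →
        ∀ δ : ℝ, 0 < δ →
          0 < C₁ γ δ ∧
          ∀ m d : ℕ, 4 ≤ m → 1 ≤ d →
          ∀ p : Polynomial (ZMod b), Irreducible p → p.natDegree = m →
            (∃ g, CBC b γ m p d g) ∧
            ∀ g : Fin d → Polynomial (ZMod b), CBC b γ m p d g →
              (∀ j, g j ∈ Gstar b m) ∧
              ∀ α : ℝ, 1 < α →
                latticeError b α (fun u => γ u ^ α) m p g ≤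
                  ENNReal.ofReal (errorBound b α δ (C₁ γ δ) (fun u => γ u ^ α) m d)) ∧
      (∀ α : ℝ, 1 < α →
        ∀ γ : Finset ℕ → ℝ, (∀ u, 0 < γ u) →
        Summable (fun j : ℕ => maxPreceding j fun v => (γ (insert j v) / γ v) ^ (1 / α)) →
        ∀ δ : ℝ, 0 < δ →
          0 < C₂ (fun u => γ u ^ (1 / α)) δ ∧
          ∀ m d : ℕ, 4 ≤ m → 1 ≤ d →
          ∀ p : Polynomial (ZMod b), Irreducible p → p.natDegree = m →
            (∃ g, CBC b (fun u => γ u ^ (1 / α)) m p d g) ∧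
            ∀ g : Fin d → Polynomial (ZMod b), CBC b (fun u => γ u ^ (1 / α)) m p d g →
              (∀ j, g j ∈ Gstar b m) ∧
              latticeError b α γ m p g ≤
                ENNReal.ofReal
                  (errorBound b α δ (C₂ (fun u => γ u ^ (1 / α)) δ) γ m d)) := by
  classical
  -- The constant of the weights `η` and of `δ`, with the value `1` where the hypotheses fail.
  let C : (Finset ℕ → ℝ) → ℝ → ℝ := fun η δ =>
    if h : (∀ u, 0 < η u) ∧ (Summable fun j : ℕ => maxPreceding j fun v => η (insert j v) / η v) ∧
      0 < δ then (exists_errorBound (b := b) h.1 h.2.1 h.2.2).choose else 1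
  have hC : ∀ η : Finset ℕ → ℝ, (∀ u, 0 < η u) →
      (Summable fun j : ℕ => maxPreceding j fun v => η (insert j v) / η v) → ∀ δ : ℝ, 0 < δ →
      0 < C η δ ∧ ∀ m d : ℕ, m ≠ 0 → ∀ p : Polynomial (ZMod b), Irreducible p → p.natDegree = m →
        ∀ g : Fin d → Polynomial (ZMod b), CBC b η m p d g → ∀ α : ℝ, 1 < α →
          latticeError b α (fun u => η u ^ α) m p g ≤
            ENNReal.ofReal (errorBound b α δ (C η δ) (fun u => η u ^ α) m d) := by
    intro η h1 h2 δ h3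
    have h : (∀ u, 0 < η u) ∧
      (Summable fun j : ℕ => maxPreceding j fun v => η (insert j v) / η v) ∧ 0 < δ := ⟨h1, h2, h3⟩
    simp only [C, dif_pos h]
    exact (exists_errorBound (b := b) h1 h2 h3).choose_spec
  refine ⟨C, C, fun γ hγ hs δ hδ => ?_, fun α hα γ hγ hs δ hδ => ?_⟩
  · obtain ⟨hpos, h⟩ := hC γ hγ hs δ hδ
    refine ⟨hpos, fun m d hm hd p hp hdeg => ⟨exists_CBC γ (by omega) hd, fun g hg => ?_⟩⟩
    exact ⟨hg.mem_Gstar (by omega), h m d (by omega) p hp hdeg g hg⟩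
  · -- The second part is the first one for the weights `γ ^ (1 / α)`, whose `α`-th power is `γ`.
    have hη : ∀ u, 0 < γ u ^ (1 / α) := fun u => Real.rpow_pos_of_pos (hγ u) _
    have hpow : (fun u => (γ u ^ (1 / α)) ^ α) = γ := by
      funext u
      rw [← Real.rpow_mul (hγ u).le, one_div_mul_cancel (by linarith), Real.rpow_one]
    simp_rw [Real.div_rpow (hγ _).le (hγ _).le] at hs
    obtain ⟨hpos, h⟩ := hC (fun u => γ u ^ (1 / α)) hη hs δ hδ
    refine ⟨hpos, fun m d hm hd p hp hdeg => ⟨exists_CBC _ (by omega) hd, fun g hg => ?_⟩⟩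
    have h1 := h m d (by omega) p hp hdeg g hg α hα
    rw [hpow] at h1
    exact ⟨hg.mem_Gstar (by omega), h1⟩
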